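/- Let $X$ be an infinite-dimensional Banach space over $\mathbb K\in\{\mathbb R,\mathbb C\}$, and let $\mathcal B=(x_i)_{i\in\mathbb N}$ be a bounded Markushevich basis of $X$ with bounded dual basis $\mathcal B^*=(x_i^*)_{i\in\mathbb N}\subset X^*$, that is, $x_i^*(x_j)=\delta_{ij}$, the span of $\mathcal B$ is dense in $X$, and $\mathcal B^*$ is total. Let $w=(w_i)$ be a sequence of positive numbers, $w(A)=\sum_{i\in A}w_i\in[0,\infty]$ for $A\subset\mathbb N$, $\operatorname{supp}(x)=\{i: x_i^*(x)\neq0\}$, and $P_A(x)=\sum_{i\in A}x_i^*(x)x_i$, $\mathbf 1_{\varepsilon,A}=\sum_{i\in A}\varepsilon_i x_i$ for finite $A$ and scalars $\varepsilon_i$ with $|\varepsilon_i|=1$. A finite set $A$ is $t$-greedy for $x$ if $|x_i^*(x)|\ge t|x_j^*(x)|$ for all $i\in A$, $j\notin A$; it is greedy if $t=1$. Let $C>0$, $0<s\le1$, and suppose that $\mathcal B$ is $C$-$s$-$w$-semi-greedy: for every $x\in X$ and $m\ge1$ there are an $s$-greedy set $A$ for $x$ with $|A|=m$ and $y\in X$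 with $\operatorname{supp}(y)\subset A$ such that $\|x-y\|\le C\inf\{\|x-z\|:\ |\operatorname{supp}(z)|<\infty,\ w(\operatorname{supp}(z))\le w(A)\}$. Suppose also that some subsequence of $w$ belongs to $c_0\setminus\ell_1$. The finite-dimensional separation constant of a sequence $(u_i)$ in $X$ is the least $M>0$ (and $\infty$ if there is none) such that for every separable subspace $Z\subset X$ and every $\epsilon>0$ there is a basic subsequence $(u_{i_k})$ with basis constant at most $M+\epsilon$ such that for every finite-dimensional $F\subset Z$ there is $j$ with $\|x\|\le(M+\epsilon)\|x+z\|$ for all $x\in F$ and all $z$ in the closed span of $(u_{i_k})_{k>j}$. Let $M>0$ be such that every block basis $(v_k)$ of $\mathcal B$ for which $(w(\operatorname{supp}(v_k)))_k$ is bounded has finite-dimensional separation constant at most $M$. Then: (i) For all $x\in X$, $0<t\le1$, every finite $t$-greedy set $A$ for $x$, and every $y\in X$ with $w(\operatorname{supp}(y))\le w(A)$ and $\operatorname{supp}(y)\cap A=\emptyset$, $$\|x-P_A(x)\|\le C M\,(1+6C\,t^{-1}s^{-3})\,\|x-y\|.$$ In particular, $\mathcal B$ is $w$-almost greedy with constant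 $K=CM(1+6Cs^{-3})$: $\|x-P_A(x)\|\le K\inf\{\|x-P_B(x)\|: B\text{ finite},\ w(B)\le w(A)\}$ for every $x\in X$ and every finite greedy set $A$ for $x$. (ii) For every nonempty finite $A\subset\mathbb N$, all scalars $\varepsilon_i$ ($i\in A$) of modulus one and every $x\in X$ with $w(A)\le w(\{i:|x_i^*(x)|\ge1\})$, $$\|\mathbf 1_{\varepsilon,A}\|\le 4s^{-3}C^2M\,\|x\|.$$ Consequently, with $K'=4s^{-3}C^2M$, $\mathcal B$ is $K'$-$w$-superdemocratic, that is, $\|\mathbf 1_{\varepsilon,A}\|\le K'\|\mathbf 1_{\varepsilon',B}\|$ for all finite $A,B$ with $w(A)\le w(B)$ and all signs $\varepsilon,\varepsilon'$; and it is $K'$-truncation quasi-greedy, that is, $\min_{i\in A}|x_i^*(x)|\,\|\mathbf 1_{\varepsilon(x),A}\|\le K'\|x\|$ for all $x\in X$ and all nonempty finite $A$, where $\varepsilon(x)_i=\operatorname{sgn}(x_i^*(x))$, $\operatorname{sgn}(a)a=|a|$, $\operatorname{sgn}(0)=1$. Moreover, if $\mathcal B^*$ is $r$-norming for some $0<r\le1$,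 that is, $r\|x\|\le\sup\{|g(x)|: g\in\operatorname{span}\mathcal B^*,\ \|g\|=1\}$ for all $x\in X$, then the above hypothesis on block bases, and hence all of the above conclusions, hold with $M=r^{-1}$. -/

import Mathlib

open Filter Topology
open scoped ENNReal

namespace WeightGreedy

noncomputable section

variable {𝕜 : Type*} [RCLike 𝕜] {X : Type*} [NormedAddCommGroup X] [NormedSpace 𝕜 X]

/-! ### Markushevich bases -/

/-- `e` is a bounded Markushevich basis of `X` with bounded dual basis `f`: the two sequences are
biorthogonal, the span of `e` is dense, and the functionals `f i` are total, that is, they separate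
the points of `X` (equivalently, their span is weak-star dense in the dual). -/
structure IsMarkushevichBasis (e : ℕ → X) (f : ℕ → StrongDual 𝕜 X) : Prop where
  biorthogonal : ∀ i j, f i (e j) = if i = j then 1 else 0
  fundamental : Dense (Submodule.span 𝕜 (Set.range e) : Set X)
  total : ∀ x : X, (∀ i, f i x = 0) → x = 0
  bounded_basis : ∃ c : ℝ, ∀ i, ‖e i‖ ≤ c
  bounded_dual : ∃ c : ℝ, ∀ i, ‖f i‖ ≤ c

/-- The support of a vector with respect to the dual basis `f`. -/
def supp (f : ℕ → StrongDual 𝕜 X) (x : X) : Set ℕ := {i | f i x ≠ 0}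

/-- The projection `P_A x = ∑ i ∈ A, f i x • e i` on a finite set `A`. -/
def proj (e : ℕ → X) (f : ℕ → StrongDual 𝕜 X) (A : Finset ℕ) (x : X) : X :=
  ∑ i ∈ A, f i x • e i

/-- The vector `1_{ε, A} = ∑ i ∈ A, ε i • e i`. -/
def signedSum (e : ℕ → X) (ε : ℕ → 𝕜) (A : Finset ℕ) : X := ∑ i ∈ A, ε i • e i

/-- `ε` is a family of scalars of modulus one on `A`. -/
def IsSign (ε : ℕ → 𝕜) (A : Finset ℕ) : Prop := ∀ i ∈ A, ‖ε i‖ = 1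

open Classical in
/-- The sign of a scalar: `sgn 0 = 1`, and `sgn t * t = |t|`. -/
def sgn (t : 𝕜) : 𝕜 := if t = 0 then 1 else (‖t‖ : 𝕜) / t

/-- The dual basis `f` is `r`-norming: on the unit sphere of its linear span the supremum of
`|g x|` is at least `r * ‖x‖`. -/
def IsNorming (r : ℝ) (f : ℕ → StrongDual 𝕜 X) : Prop :=
  ∀ x : X, r * ‖x‖ ≤
    ⨆ g : {g : StrongDual 𝕜 X // g ∈ Submodule.span 𝕜 (Set.range f) ∧ ‖g‖ = 1}, ‖g.1 x‖

/-- `v` is a block basis of `e`. -/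
def IsBlockBasis (𝕜 : Type*) [RCLike 𝕜] {X : Type*} [NormedAddCommGroup X] [NormedSpace 𝕜 X]
    (e v : ℕ → X) : Prop :=
  ∃ (b : ℕ → 𝕜) (n m : ℕ → ℕ),
    (∀ i, n i ≤ m i ∧ m i < n (i + 1)) ∧
    (∀ i, ∃ k ∈ Finset.Icc (n i) (m i), b k ≠ 0) ∧
    ∀ i, v i = ∑ k ∈ Finset.Icc (n i) (m i), b k • e k

/-! ### Finite dimensional separation -/

/-- `u` is a basic sequence with basis constant at most `K`: it is a Schauder basis of the closure
of its span, and the partial sum projections have norm at most `K`. -/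
def IsBasicSequenceWith (𝕜 : Type*) [RCLike 𝕜] {X : Type*} [NormedAddCommGroup X]
    [NormedSpace 𝕜 X] (u : ℕ → X) (K : ℝ) : Prop :=
  ∃ b : SchauderBasis 𝕜 (Submodule.span 𝕜 (Set.range u)).topologicalClosure,
    (∀ k, (b.basis k : X) = u k) ∧ ∀ n, ‖b.proj n‖ ≤ K

/-- The subsequence `u ∘ φ` is a finite dimensional separating sequence for `(Z, M, δ)`. -/
def IsSeparatingSubsequence (u : ℕ → X) (φ : ℕ → ℕ) (Z : Submodule 𝕜 X) (M δ : ℝ) : Prop :=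
  StrictMono φ ∧ IsBasicSequenceWith 𝕜 (u ∘ φ) (M + δ) ∧
    ∀ F : Submodule 𝕜 X, FiniteDimensional 𝕜 F → F ≤ Z →
      ∃ j : ℕ, ∀ x ∈ F,
        ∀ z ∈ (Submodule.span 𝕜 {y | ∃ k, j < k ∧ y = u (φ k)}).topologicalClosure,
          ‖x‖ ≤ (M + δ) * ‖x + z‖

/-- `u` has the finite dimensional separation property with constant `M`. -/
def HasFDSPWith (𝕜 : Type*) [RCLike 𝕜] {X : Type*} [NormedAddCommGroup X] [NormedSpace 𝕜 X]
    (u : ℕ → X) (M : ℝ) : Prop :=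
  ∀ Z : Submodule 𝕜 X, TopologicalSpace.IsSeparable (Z : Set X) → ∀ δ : ℝ, 0 < δ →
    ∃ φ : ℕ → ℕ, IsSeparatingSubsequence u φ Z M δ

/-- The finite dimensional separation constant of `u`: the least positive constant with which `u`
has the finite dimensional separation property (`∞` if there is none). -/
def fdsConstant (𝕜 : Type*) [RCLike 𝕜] {X : Type*} [NormedAddCommGroup X] [NormedSpace 𝕜 X]
    (u : ℕ → X) : ℝ≥0∞ :=
  sInf {c | ∃ M : ℝ, 0 < M ∧ HasFDSPWith 𝕜 u M ∧ c = ENNReal.ofReal M}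

/-! ### Weights and greedy-type properties -/

/-- The `w`-measure `w(A) = ∑ i ∈ A, w i` of a set of indices, possibly infinite. -/
def weight (w : ℕ → ℝ) (A : Set ℕ) : ℝ≥0∞ := ∑' i : A, ENNReal.ofReal (w i)

/-- `A` is a `t`-greedy set for `x`: `min_{i ∈ A} |f i x| ≥ t * max_{j ∉ A} |f j x|`. -/
def IsGreedySet (f : ℕ → StrongDual 𝕜 X) (t : ℝ) (x : X) (A : Finset ℕ) : Prop :=
  ∀ i ∈ A, ∀ j ∉ A, t * ‖f j x‖ ≤ ‖f i x‖

/-- The basis is `C`-`s`-`w`-semi-greedy: for every `x` and every `m ≥ 1` there are an `s`-greedy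
set `A` of cardinality `m` and a vector `y` supported in `A` such that `‖x - y‖` is at most `C`
times the infimum of `‖x - z‖` over all finitely supported `z` with `w(supp z) ≤ w(A)`. -/
def IsWeakSemiGreedy (f : ℕ → StrongDual 𝕜 X) (w : ℕ → ℝ) (C s : ℝ) : Prop :=
  ∀ x : X, ∀ m : ℕ, 1 ≤ m →
    ∃ A : Finset ℕ, A.card = m ∧ IsGreedySet f s x A ∧
      ∃ y : X, supp f y ⊆ A ∧
        ‖x - y‖ ≤ C * ⨅ z : {z : X // (supp f z).Finite ∧ weight w (supp f z) ≤ weight w A},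
          ‖x - z.1‖

/-- The basis is `K`-`w`-almost greedy (for all greedy sets of `x`). -/
def IsWeightAlmostGreedy (e : ℕ → X) (f : ℕ → StrongDual 𝕜 X) (w : ℕ → ℝ) (K : ℝ) : Prop :=
  ∀ x : X, ∀ A : Finset ℕ, IsGreedySet f 1 x A →
    ‖x - proj e f A x‖ ≤
      K * ⨅ B : {B : Finset ℕ // weight w B ≤ weight w A}, ‖x - proj e f B.1 x‖

/-- The basis is `K`-`w`-superdemocratic. -/
def IsWeightSuperdemocratic (𝕜 : Type*) [RCLike 𝕜] {X : Type*} [NormedAddCommGroup X]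
    [NormedSpace 𝕜 X] (e : ℕ → X) (w : ℕ → ℝ) (K : ℝ) : Prop :=
  ∀ A B : Finset ℕ, weight w A ≤ weight w B →
    ∀ ε ε' : ℕ → 𝕜, IsSign ε A → IsSign ε' B →
      ‖signedSum e ε A‖ ≤ K * ‖signedSum e ε' B‖

/-- The basis is `K`-truncation quasi-greedy. -/
def IsTruncationQuasiGreedy (e : ℕ → X) (f : ℕ → StrongDual 𝕜 X) (K : ℝ) : Prop :=
  ∀ x : X, ∀ (A : Finset ℕ) (hA : A.Nonempty),
    A.inf' hA (fun i => ‖f i x‖) * ‖signedSum e (fun i => sgn (f i x)) A‖ ≤ K * ‖x‖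

/-- Every block basis of `e` whose supports have bounded `w`-measure has finite dimensional
separation constant at most `M`. -/
def BoundedWeightBlocksSeparate (e : ℕ → X) (f : ℕ → StrongDual 𝕜 X) (w : ℕ → ℝ) (M : ℝ) : Prop :=
  ∀ v : ℕ → X, IsBlockBasis 𝕜 e v →
    (∃ R : ℝ, ∀ k, weight w (supp f (v k)) ≤ ENNReal.ofReal R) →
      fdsConstant 𝕜 v ≤ ENNReal.ofReal M

/-- The estimates for the thresholding algorithm with parameter `M`. -/
structure ThresholdingEstimates (e : ℕ → X) (f : ℕ → StrongDual 𝕜 X) (w : ℕ → ℝ) (C s M : ℝ) :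
    Prop where
  greedy_bound : ∀ (x : X) (t : ℝ), 0 < t → t ≤ 1 → ∀ A : Finset ℕ, IsGreedySet f t x A →
    ∀ y : X, weight w (supp f y) ≤ weight w A → Disjoint (supp f y) (A : Set ℕ) →
      ‖x - proj e f A x‖ ≤ C * M * (1 + 6 * C * t⁻¹ * s⁻¹ ^ 3) * ‖x - y‖
  almostGreedy : IsWeightAlmostGreedy e f w (C * M * (1 + 6 * C * s⁻¹ ^ 3))
  signedSum_bound : ∀ A : Finset ℕ, A.Nonempty → ∀ ε : ℕ → 𝕜, IsSign ε A → ∀ x : X,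
    weight w A ≤ weight w {i | 1 ≤ ‖f i x‖} →
      ‖signedSum e ε A‖ ≤ 4 * s⁻¹ ^ 3 * C ^ 2 * M * ‖x‖
  superdemocratic : IsWeightSuperdemocratic 𝕜 e w (4 * s⁻¹ ^ 3 * C ^ 2 * M)
  truncationQuasiGreedy : IsTruncationQuasiGreedy e f (4 * s⁻¹ ^ 3 * C ^ 2 * M)

end

end WeightGreedy

/-! The semi-greedy property says nothing about which greedy set or which approximant occurs. The
remedy is to add to a vector a multiple of a signed sum over a far away set `D`, chosen so that the
sets involved are forced, and then to remove `D` by separation. Since a subsequence of `w` is null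
and not summable, such `D` exist with almost any prescribed weight.

Two estimates carry the theorem. If the coordinates of `u` are at most `b` and `β > b / s`, then `D`
is the only `s`-greedy set of its size for `u + β 1_D`. Separating `u` from vectors on `D` therefore
bounds `‖u‖` by about `M C ‖u - p + β 1_D‖` whenever `w(supp p) ≤ w(D)` (`exists_forall_norm_le`).
Conversely, if `x` has coordinates at least one on `B`, a small multiple of `1_D` with `w(D) ≤ w(B)`
leaves `D` out of the greedy set, so `x + μ 1_D` is within `C ‖x‖` of a compact set not depending on
`D`. Two disjoint choices of `D` with nearby approximants can be subtracted, so the difference of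
their sums is controlled by `‖x‖` (`exists_signedSum_le`).

Taking `u = p = 1_{ε,A}` gives the bound on signed sums. Taking `u = x - P_A x` and `p = y - P_A x`
gives `u - p = x - y`, hence the greedy bound for finitely supported `y`. Passing to arbitrary `y`
requires approximants supported inside `supp y` (`exists_finite_supp_subset_near`). For a norming
dual basis, Mazur's compactness argument gives the separation. -/

namespace WeightGreedy

/-! ### Finite sets of prescribed weight. -/

section Weights

variable {w : ℕ → ℝ}

theorem weight_coe_finset (hw : ∀ i, 0 < w i) (A : Finset ℕ) :
    weight w (A : Set ℕ) = ENNReal.ofReal (∑ i ∈ A, w i) := by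
  rw [weight, ENNReal.ofReal_sum_of_nonneg fun i _ => (hw i).le]
  exact Finset.tsum_subtype' A fun i => ENNReal.ofReal (w i)

theorem weight_mono {A B : Set ℕ} (h : A ⊆ B) : weight w A ≤ weight w B :=
  ENNReal.tsum_mono_subtype (fun i => ENNReal.ofReal (w i)) h

theorem weight_coe_le_iff (hw : ∀ i, 0 < w i) {A B : Finset ℕ} :
    weight w (A : Set ℕ) ≤ weight w (B : Set ℕ) ↔ ∑ i ∈ A, w i ≤ ∑ i ∈ B, w i := by
  rw [weight_coe_finset hw, weight_coe_finset hw,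
    ENNReal.ofReal_le_ofReal_iff (Finset.sum_nonneg fun i _ => (hw i).le)]

/-- If a subsequence of `w` tends to zero and is not summable, there are finite sets arbitrarily
far away whose weight is a prescribed number up to an arbitrarily small error. -/
theorem exists_finset_weight (hw : ∀ i, 0 < w i)
    (hsub : ∃ φ : ℕ → ℕ, StrictMono φ ∧ Tendsto (w ∘ φ) atTop (𝓝 0) ∧ ¬ Summable (w ∘ φ))
    (N : ℕ) {a η : ℝ} (ha : 0 < a) (hη : 0 < η) :
    ∃ D : Finset ℕ, D.Nonempty ∧ (∀ i ∈ D, N ≤ i) ∧ a - η < ∑ i ∈ D, w i ∧ ∑ i ∈ D, w i ≤ a := by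
  obtain ⟨φ, hφ, hlim, hns⟩ := hsub
  -- With `η ≤ a` the empty sum does not exceed `a - η`, so the set found below is nonempty.
  wlog hηa : η ≤ a generalizing η
  · obtain ⟨D, h1, h2, h3, h4⟩ := this ha le_rfl
    exact ⟨D, h1, h2, by push Not at hηa; linarith, h4⟩
  obtain ⟨k, hk⟩ := eventually_atTop.1 (hlim.eventually (gt_mem_nhds hη))
  set K := max k N with hK
  have hns' : ¬ Summable fun n => w (φ (n + K)) := fun h => hns ((summable_nat_add_iff K).1 h)
  -- Stop at the first partial sum above `a - η`: its last term is below `η`, so it cannot exceed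
  -- `a`.
  have hex : ∃ n, a - η < ∑ i ∈ Finset.range n, w (φ (i + K)) := by
    by_contra! hcon
    exact hns' (summable_of_sum_range_le (fun n => (hw _).le) hcon)
  classical
  let n := Nat.find hex
  have hn : a - η < ∑ i ∈ Finset.range n, w (φ (i + K)) := Nat.find_spec hex
  have hinj : Function.Injective fun i => φ (i + K) :=
    hφ.injective.comp (add_left_injective K)
  have hn0 : n ≠ 0 := by
    intro h0
    rw [h0] at hn
    simp at hn
    linarith
  obtain ⟨p, hp⟩ := Nat.exists_eq_succ_of_ne_zero hn0
  have hsum : ∑ i ∈ (Finset.range n).image (fun i => φ (i + K)), w i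
      = ∑ i ∈ Finset.range n, w (φ (i + K)) := Finset.sum_image fun i _ j _ h => hinj h
  refine ⟨(Finset.range n).image fun i => φ (i + K), ?_, ?_, hsum ▸ hn, ?_⟩
  · simpa using hn0
  · intro i hi
    obtain ⟨j, -, rfl⟩ := Finset.mem_image.1 hi
    have := hφ.id_le (j + K)
    simp only [id] at this
    omega
  · have hpn : ¬ a - η < ∑ i ∈ Finset.range p, w (φ (i + K)) :=
      Nat.find_min hex (show p < n by omega)
    have h1 : w (φ (p + K)) < η := hk (p + K) (by omega)
    rw [hsum, hp, Nat.succ_eq_add_one, Finset.sum_range_succ]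
    linarith

end Weights

variable {𝕜 : Type*} [RCLike 𝕜] {X : Type*} [NormedAddCommGroup X] [NormedSpace 𝕜 X]
  {e : ℕ → X} {f : ℕ → StrongDual 𝕜 X} {w : ℕ → ℝ} {C s M : ℝ}

/-! ### Signed sums and coordinates. -/

theorem signedSum_add (c d : ℕ → 𝕜) (A : Finset ℕ) :
    signedSum e (c + d) A = signedSum e c A + signedSum e d A := by
  simp [signedSum, add_smul, Finset.sum_add_distrib]

theorem signedSum_smul (a : 𝕜) (c : ℕ → 𝕜) (A : Finset ℕ) :
    signedSum e (a • c) A = a • signedSum e c A := by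
  simp [signedSum, Finset.smul_sum, smul_smul]

theorem signedSum_congr {c d : ℕ → 𝕜} {A : Finset ℕ} (h : ∀ i ∈ A, c i = d i) :
    signedSum e c A = signedSum e d A :=
  Finset.sum_congr rfl fun i hi => by rw [h i hi]

theorem signedSum_union (c d : ℕ → 𝕜) {A B : Finset ℕ} (h : Disjoint A B) :
    signedSum e (fun i => if i ∈ A then c i else d i) (A ∪ B)
      = signedSum e c A + signedSum e d B := by
  rw [signedSum, Finset.sum_union h]
  congr 1
  · exact Finset.sum_congr rfl fun i hi => by rw [if_pos hi]
  · exact Finset.sum_congr rfl fun i hi => by rw [if_neg (Finset.disjoint_right.1 h hi)]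

theorem IsSign.union {c d : ℕ → 𝕜} {A B : Finset ℕ} (hc : IsSign c A) (hd : IsSign d B) :
    IsSign (fun i => if i ∈ A then c i else d i) (A ∪ B) := by
  intro i hi
  by_cases h : i ∈ A
  · simpa [h] using hc i h
  · simpa [h] using hd i ((Finset.mem_union.1 hi).resolve_left h)

theorem signedSum_mem_span (c : ℕ → 𝕜) {A : Finset ℕ} {S : Set ℕ} (h : ∀ i ∈ A, i ∈ S) :
    signedSum e c A ∈ Submodule.span 𝕜 (e '' S) :=
  Submodule.sum_mem _ fun i hi =>
    Submodule.smul_mem _ _ (Submodule.subset_span ⟨i, h i hi, rfl⟩)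

namespace IsMarkushevichBasis

variable (hB : IsMarkushevichBasis e f)

include hB

theorem coord_signedSum (c : ℕ → 𝕜) (A : Finset ℕ) (j : ℕ) :
    f j (signedSum e c A) = if j ∈ A then c j else 0 := by
  simp [signedSum, map_sum, hB.biorthogonal]

theorem supp_signedSum_subset (c : ℕ → 𝕜) (A : Finset ℕ) : supp f (signedSum e c A) ⊆ A := by
  intro j hj
  by_contra h
  exact hj (by rw [hB.coord_signedSum, if_neg (by simpa using h)])

theorem ext {x y : X} (h : ∀ i, f i x = f i y) : x = y :=
  sub_eq_zero.1 (hB.total _ fun i => by rw [map_sub, h i, sub_self])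

theorem eq_signedSum {x : X} {A : Finset ℕ} (h : supp f x ⊆ A) :
    x = signedSum e (fun i => f i x) A := by
  refine hB.ext fun j => ?_
  rw [hB.coord_signedSum]
  split_ifs with hj
  · rfl
  · by_contra h0
    exact hj (h h0)

theorem ne_zero (i : ℕ) : e i ≠ 0 := by
  intro h
  have := hB.biorthogonal i i
  simp [h] at this

theorem finite_supp_of_mem_span {x : X} (hx : x ∈ Submodule.span 𝕜 (Set.range e)) :
    (supp f x).Finite := by
  induction hx using Submodule.span_induction with
  | mem x hx =>
    obtain ⟨i, rfl⟩ := hx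
    refine (Set.finite_singleton i).subset fun j hj => ?_
    by_contra h
    exact hj (by rw [hB.biorthogonal, if_neg (by simpa using h)])
  | zero => simp [supp]
  | add x y _ _ hx hy =>
    refine (hx.union hy).subset fun j hj => ?_
    by_contra h
    simp only [supp, Set.mem_union, Set.mem_ofPred_eq, not_or, not_not] at h hj
    exact hj (by rw [map_add, h.1, h.2, add_zero])
  | smul a x _ hx =>
    refine hx.subset fun j hj => ?_
    by_contra h
    simp only [supp, Set.mem_ofPred_eq, not_not] at h hj
    exact hj (by rw [map_smul, h, smul_zero])

theorem exists_bound : ∃ c : ℝ, 0 < c ∧ ∀ i (x : X), ‖f i x‖ ≤ c * ‖x‖ := by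
  obtain ⟨c, hc⟩ := hB.bounded_dual
  refine ⟨max c 1, by positivity, fun i x => ((f i).le_opNorm x).trans ?_⟩
  gcongr
  exact (hc i).trans (le_max_left _ _)

theorem exists_finite_supp_near (x : X) {η : ℝ} (hη : 0 < η) :
    ∃ z : X, (supp f z).Finite ∧ ‖x - z‖ < η := by
  obtain ⟨z, hz, hd⟩ := Metric.dense_iff.1 hB.fundamental x η hη
  refine ⟨z, hB.finite_supp_of_mem_span hd, ?_⟩
  rw [← dist_eq_norm, dist_comm]
  exact hz

/-- Coordinates tend to zero: this is clear on the dense span, and the dual basis is bounded. -/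
theorem finite_large_coord (x : X) {η : ℝ} (hη : 0 < η) : {i | η ≤ ‖f i x‖}.Finite := by
  obtain ⟨c, hc, hf⟩ := hB.exists_bound
  obtain ⟨z, hz, hd⟩ := hB.exists_finite_supp_near x (div_pos hη hc)
  refine hz.subset fun i hi => fun h0 => ?_
  have h1 := hf i (x - z)
  rw [map_sub, h0, sub_zero] at h1
  have h2 : c * ‖x - z‖ < η := by rwa [lt_div_iff₀' hc] at hd
  exact absurd (hi.trans h1) (not_le.2 h2)

theorem exists_forall_coord_lt (x : X) {η : ℝ} (hη : 0 < η) : ∃ N, ∀ i, N ≤ i → ‖f i x‖ < η := by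
  obtain ⟨N, hN⟩ := (hB.finite_large_coord x hη).bddAbove
  refine ⟨N + 1, fun i hi => ?_⟩
  by_contra! h
  have := hN h
  omega

end IsMarkushevichBasis

/-! ### First consequences of semi-greediness. -/

theorem IsWeakSemiGreedy.exists_approx (hSG : IsWeakSemiGreedy f w C s) (hC : 0 ≤ C) (x : X)
    {m : ℕ} (hm : 1 ≤ m) :
    ∃ A : Finset ℕ, A.card = m ∧ IsGreedySet f s x A ∧ ∃ y : X, supp f y ⊆ A ∧
      ∀ z : X, (supp f z).Finite → weight w (supp f z) ≤ weight w A → ‖x - y‖ ≤ C * ‖x - z‖ := by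
  obtain ⟨A, hA, hg, y, hy, hle⟩ := hSG x m hm
  refine ⟨A, hA, hg, y, hy, fun z hz hwz => hle.trans ?_⟩
  gcongr
  exact ciInf_le (f := fun z : {z : X // (supp f z).Finite ∧ weight w (supp f z) ≤ weight w A} =>
    ‖x - z.1‖) ⟨0, by rintro _ ⟨z, rfl⟩; exact norm_nonneg _⟩ ⟨z, hz, hwz⟩

/-- The approximant competes with itself, so `C < 1` would make it exact; but `e 0 + e 1` is not
supported on a single index. -/
theorem IsWeakSemiGreedy.one_le (hSG : IsWeakSemiGreedy f w C s) (hC : 0 ≤ C)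
    (hB : IsMarkushevichBasis e f) : 1 ≤ C := by
  obtain ⟨A, hA, -, y, hy, hle⟩ := hSG.exists_approx hC (e 0 + e 1) le_rfl
  have h1 := hle y (A.finite_toSet.subset hy) (weight_mono hy)
  by_contra! hlt
  have h0 : ‖e 0 + e 1 - y‖ = 0 := by
    have := norm_nonneg (e 0 + e 1 - y)
    nlinarith
  have hyx : y = e 0 + e 1 := (sub_eq_zero.1 (norm_eq_zero.1 h0)).symm
  have hm : ∀ i ∈ ({0, 1} : Finset ℕ), i ∈ A := by
    intro i hi
    apply Finset.mem_coe.1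
    apply hy
    simp only [supp, Set.mem_ofPred_eq, hyx, map_add, hB.biorthogonal]
    simp only [Finset.mem_insert, Finset.mem_singleton] at hi
    rcases hi with rfl | rfl <;> simp
  have := Finset.card_le_card (show ({0, 1} : Finset ℕ) ⊆ A from hm)
  simp [hA] at this

/-- When the coordinates of `x` on `D` dominate the others, the semi-greedy property applies
with the set `D` itself. -/
theorem IsWeakSemiGreedy.exists_of_dominant (hSG : IsWeakSemiGreedy f w C s) (hC : 0 ≤ C)
    (hB : IsMarkushevichBasis e f) (x : X) {D : Finset ℕ} (hD : D.Nonempty)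
    (hdom : ∀ i ∉ D, ∀ j ∈ D, ‖f i x‖ < s * ‖f j x‖) :
    ∃ c : ℕ → 𝕜, ∀ z : X, (supp f z).Finite → weight w (supp f z) ≤ weight w D →
      ‖x + signedSum e c D‖ ≤ C * ‖x - z‖ := by
  obtain ⟨A, hA, hg, y, hy, hle⟩ := hSG.exists_approx hC x hD.card_pos
  have hAD : A = D := by
    refine Finset.eq_of_subset_of_card_le (fun i hi => ?_) hA.ge
    by_contra hiD
    obtain ⟨j, hjD, hjA⟩ : ∃ j ∈ D, j ∉ A := by
      by_contra! h
      exact hiD (Finset.eq_of_subset_of_card_le h hA.le ▸ hi)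
    exact absurd (hg i hi j hjA) (not_le.2 (hdom i hiD j hjD))
  subst hAD
  refine ⟨fun i => -f i y, fun z hz hwz => ?_⟩
  convert hle z hz hwz using 2
  conv_rhs => rw [hB.eq_signedSum hy]
  simp [signedSum, sub_eq_add_neg]

/-! ### Separation from far away blocks. -/

theorem exists_hasFDSPWith_lt {u : ℕ → X} (h : fdsConstant 𝕜 u ≤ ENNReal.ofReal M) (hM : 0 < M)
    {δ : ℝ} (hδ : 0 < δ) : ∃ M', 0 < M' ∧ M' < M + δ ∧ HasFDSPWith 𝕜 u M' := by
  have hlt : fdsConstant 𝕜 u < ENNReal.ofReal (M + δ) :=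
    h.trans_lt ((ENNReal.ofReal_lt_ofReal_iff (by linarith)).2 (by linarith))
  obtain ⟨_, ⟨M', h0, h1, rfl⟩, h2⟩ := sInf_lt_iff.1 hlt
  exact ⟨M', h0, (ENNReal.ofReal_lt_ofReal_iff (by linarith)).1 h2, h1⟩

/-- A separating subsequence for a finite dimensional subspace, with one constant. -/
theorem exists_separating {u : ℕ → X} (h : fdsConstant 𝕜 u ≤ ENNReal.ofReal M) (hM : 0 < M)
    (F : Submodule 𝕜 X) [FiniteDimensional 𝕜 F] {δ : ℝ} (hδ : 0 < δ) :
    ∃ k, ∀ x ∈ F, ∀ a : 𝕜, ‖x‖ ≤ (M + δ) * ‖x + a • u k‖ := by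
  obtain ⟨M', h0, h1, hu⟩ := exists_hasFDSPWith_lt h hM (half_pos hδ)
  have hsep : TopologicalSpace.IsSeparable (F : Set X) := by
    have : ProperSpace F := FiniteDimensional.proper 𝕜 F
    exact TopologicalSpace.IsSeparable.of_subtype (F : Set X)
  obtain ⟨φ, -, -, hφ⟩ := hu F hsep (δ / 2) (half_pos hδ)
  obtain ⟨j, hj⟩ := hφ F inferInstance le_rfl
  refine ⟨φ (j + 1), fun x hx a => (hj x hx (a • u (φ (j + 1))) ?_).trans ?_⟩
  · exact Submodule.le_topologicalClosure _ (Submodule.smul_mem _ _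
      (Submodule.subset_span ⟨j + 1, j.lt_succ_self, rfl⟩))
  · exact mul_le_mul_of_nonneg_right (by linarith) (norm_nonneg _)

theorem BoundedWeightBlocksSeparate.one_le (hM : BoundedWeightBlocksSeparate e f w M)
    (hM0 : 0 < M) (hB : IsMarkushevichBasis e f) (hw : ∀ i, 0 < w i)
    (hsub : ∃ φ : ℕ → ℕ, StrictMono φ ∧ Tendsto (w ∘ φ) atTop (𝓝 0) ∧ ¬ Summable (w ∘ φ)) :
    1 ≤ M := by
  obtain ⟨φ, hφ, hlim, -⟩ := hsub
  obtain ⟨R, hR⟩ := hlim.bddAbove_range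
  have hfds := hM (e ∘ φ) ⟨fun _ => 1, φ, φ, fun i => ⟨le_rfl, hφ i.lt_succ_self⟩,
    fun i => ⟨φ i, by simp⟩, fun i => by simp⟩ ⟨R, fun k => by
      have h1 : supp f ((e ∘ φ) k) ⊆ (({φ k} : Finset ℕ) : Set ℕ) := by
        intro j hj
        by_contra h
        exact hj (by rw [Function.comp, hB.biorthogonal, if_neg (by simpa using h)])
      refine (weight_mono h1).trans ?_
      rw [weight_coe_finset hw, Finset.sum_singleton]
      exact ENNReal.ofReal_le_ofReal (hR ⟨k, rfl⟩)⟩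
  refine le_of_forall_pos_le_add fun δ hδ => ?_
  obtain ⟨k, hk⟩ := exists_separating hfds hM0 (Submodule.span 𝕜 {e 0}) hδ
  have h1 := hk (e 0) (Submodule.mem_span_singleton_self _) 0
  have h2 : 0 < ‖e 0‖ := norm_pos_iff.2 (hB.ne_zero 0)
  rw [zero_smul, add_zero] at h1
  nlinarith

/-- Vectors with finite, far away support of bounded weight are uniformly separated from a given
finite dimensional subspace. -/
theorem BoundedWeightBlocksSeparate.exists_forall_le (hM : BoundedWeightBlocksSeparate e f w M)
    (hM0 : 0 < M) (hB : IsMarkushevichBasis e f) (hw : ∀ i, 0 < w i)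
    (hsub : ∃ φ : ℕ → ℕ, StrictMono φ ∧ Tendsto (w ∘ φ) atTop (𝓝 0) ∧ ¬ Summable (w ∘ φ))
    (F : Submodule 𝕜 X) [FiniteDimensional 𝕜 F] (R : ℝ) {δ : ℝ} (hδ : 0 < δ) :
    ∃ N, ∀ D : Finset ℕ, (∀ i ∈ D, N ≤ i) → ∑ i ∈ D, w i ≤ R → ∀ c : ℕ → 𝕜, ∀ x ∈ F,
      ‖x‖ ≤ (M + δ) * ‖x + signedSum e c D‖ := by
  have hM1 := hM.one_le hM0 hB hw hsub
  -- Counterexamples chosen successively further out form a block basis of bounded weight, and some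
  -- block of it must separate all of `F`.
  by_contra! hcon
  choose D hD hDR c x hxF hx using hcon
  -- A zero block cannot be a counterexample because `1 ≤ M`.
  have hne : ∀ N, ∃ i ∈ D N, c N i ≠ 0 := by
    intro N
    by_contra! h
    have h0 : signedSum e (c N) (D N) = 0 :=
      Finset.sum_eq_zero fun i hi => by rw [h i hi, zero_smul]
    have h1 := hx N
    rw [h0, add_zero] at h1
    nlinarith [norm_nonneg (x N)]
  -- the starting points of the blocks
  let n : ℕ → ℕ := fun k => Nat.rec 0 (fun _ p => (D p).sup id + 1) k
  have hn : ∀ k, n (k + 1) = (D (n k)).sup id + 1 := fun k => rfl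
  have hmem : ∀ k, ∀ i ∈ D (n k), n k ≤ i ∧ i ≤ n (k + 1) - 1 := fun k i hi =>
    ⟨hD _ i hi, by rw [hn]; exact Finset.le_sup (f := id) hi⟩
  have hlt : ∀ k, n k < n (k + 1) := by
    intro k
    obtain ⟨i, hi, -⟩ := hne (n k)
    have := hmem k i hi
    have := hn k
    omega
  have hmono : StrictMono n := strictMono_nat_of_lt_succ hlt
  have huniq : ∀ k l i, i ∈ D (n k) → i ∈ D (n l) → k = l := by
    intro k l i hk hl
    have h1 := hmem k i hk
    have h2 := hmem l i hl
    have h3 := hlt k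
    have h4 := hlt l
    by_contra hkl
    rcases Nat.lt_or_gt_of_ne hkl with h | h
    · have := hmono.monotone (show k + 1 ≤ l from h)
      omega
    · have := hmono.monotone (show l + 1 ≤ k from h)
      omega
  classical
  let b : ℕ → 𝕜 := fun i => if h : ∃ k, i ∈ D (n k) then c (n h.choose) i else 0
  have hb : ∀ k, ∀ i ∈ D (n k), b i = c (n k) i := by
    intro k i hi
    have h : ∃ k, i ∈ D (n k) := ⟨k, hi⟩
    simp only [b, dif_pos h, huniq _ _ _ h.choose_spec hi]
  have hb0 : ∀ k, ∀ i ∈ Finset.Icc (n k) (n (k + 1) - 1), i ∉ D (n k) → b i = 0 := by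
    intro k i hi hiD
    refine dif_neg ?_
    rintro ⟨l, hl⟩
    have h1 := hmem l i hl
    rw [Finset.mem_Icc] at hi
    have h3 := hlt k
    have h4 := hlt l
    rcases Nat.lt_trichotomy k l with h | h | h
    · have := hmono.monotone (show k + 1 ≤ l from h)
      omega
    · exact hiD (h ▸ hl)
    · have := hmono.monotone (show l + 1 ≤ k from h)
      omega
  have hfds := hM (fun k => signedSum e (c (n k)) (D (n k)))
    ⟨b, n, fun k => n (k + 1) - 1, fun k => ⟨Nat.le_sub_one_of_lt (hlt k),
      (Nat.sub_one_lt_of_lt (hlt k))⟩,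
      fun k => ?_, fun k => ?_⟩ ⟨R, fun k => ?_⟩
  · obtain ⟨k, hk⟩ := exists_separating hfds hM0 F hδ
    have h1 := hk _ (hxF (n k)) 1
    rw [one_smul] at h1
    exact absurd h1 (not_le.2 (hx (n k)))
  · obtain ⟨i, hi, hci⟩ := hne (n k)
    exact ⟨i, Finset.mem_Icc.2 (hmem k i hi), by rwa [hb k i hi]⟩
  · rw [← Finset.sum_subset (fun i hi => Finset.mem_Icc.2 (hmem k i hi))
      fun i hi hiD => by rw [hb0 k i hi hiD, zero_smul]]
    exact Finset.sum_congr rfl fun i hi => by rw [hb k i hi]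
  · refine (weight_mono (hB.supp_signedSum_subset _ _)).trans ?_
    rw [weight_coe_finset hw]
    exact ENNReal.ofReal_le_ofReal (hDR _)

/-! ### The two basic estimates and the bound on signed sums. -/

section Estimates

variable (hB : IsMarkushevichBasis e f) (hw : ∀ i, 0 < w i) (hC : 0 < C) (hs : 0 < s) (hs1 : s ≤ 1)
  (hSG : IsWeakSemiGreedy f w C s)
  (hsub : ∃ φ : ℕ → ℕ, StrictMono φ ∧ Tendsto (w ∘ φ) atTop (𝓝 0) ∧ ¬ Summable (w ∘ φ))

section

variable (hM0 : 0 < M) (hM : BoundedWeightBlocksSeparate e f w M)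

include hB hw hC hs hSG hsub hM0 hM

/-- A vector with small coordinates is controlled after adding a large far away signed sum and
subtracting a vector whose support has at most the same weight. -/
theorem exists_forall_norm_le (u : X) {b β : ℝ} (hb : 0 ≤ b) (hu : ∀ i, ‖f i u‖ ≤ b)
    (hβ : b / s < β) (R : ℝ) {δ : ℝ} (hδ : 0 < δ) :
    ∃ N, ∀ D : Finset ℕ, D.Nonempty → (∀ i ∈ D, N ≤ i) → ∑ i ∈ D, w i ≤ R →
      ∀ ε : ℕ → 𝕜, IsSign ε D → ∀ p : X, (supp f p).Finite → weight w (supp f p) ≤ weight w D →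
        ‖u‖ ≤ (M + δ) * (C * ‖u - p + (β : 𝕜) • signedSum e ε D‖) := by
  have hβ0 : 0 < β := lt_of_le_of_lt (by positivity) hβ
  obtain ⟨N₁, hN₁⟩ := hM.exists_forall_le hM0 hB hw hsub (Submodule.span 𝕜 {u}) R hδ
  obtain ⟨N₂, hN₂⟩ := hB.exists_forall_coord_lt u (sub_pos.2 hβ)
  refine ⟨max N₁ N₂, fun D hD hDN hDR ε hε p hp hwp => ?_⟩
  obtain ⟨c, hc⟩ := hSG.exists_of_dominant hC.le hB (u + (β : 𝕜) • signedSum e ε D) hD (by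
    intro i hi j hj
    rw [map_add, map_add, map_smul, map_smul, hB.coord_signedSum, hB.coord_signedSum, if_neg hi,
      if_pos hj, smul_zero, add_zero]
    refine (hu i).trans_lt ?_
    rw [← div_lt_iff₀' hs]
    have h1 := hN₂ j ((le_max_right _ _).trans (hDN j hj))
    have h2 : ‖(β : 𝕜) • ε j‖ = β := by
      rw [norm_smul, hε j hj, mul_one, RCLike.norm_ofReal, abs_of_pos hβ0]
    have h3 := norm_sub_le (f j u + (β : 𝕜) • ε j) (f j u)
    rw [add_sub_cancel_left, h2] at h3
    linarith)
  have h1 := hN₁ D (fun i hi => (le_max_left _ _).trans (hDN i hi)) hDR ((β : 𝕜) • ε + c) u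
    (Submodule.mem_span_singleton_self u)
  have h2 := hc p hp hwp
  rw [signedSum_add, signedSum_smul, ← add_assoc] at h1
  refine h1.trans ?_
  gcongr
  rwa [sub_add_eq_add_sub]

end

include hB hw hC hs hs1 hSG

/-- If the coordinates of `x` on `B` are at least one, then `x + μ 1_D`, for suitable `μ` and
all far away sets `D` of weight at most that of `B`, is approximated by vectors supported in a
fixed finite set whose coordinates are bounded. -/
theorem exists_approx_add_sum (x : X) {B : Finset ℕ} (hBne : B.Nonempty)
    (hxB : ∀ i ∈ B, 1 ≤ ‖f i x‖) {μ : ℝ} (hμ0 : 0 < μ) (hμs : μ < s ^ 2) :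
    ∃ (G₀ : Finset ℕ) (L : ℝ) (N₀ : ℕ), ∀ D : Finset ℕ, D.Nonempty → (∀ i ∈ D, N₀ ≤ i) →
      ∑ i ∈ D, w i ≤ ∑ i ∈ B, w i →
      ∃ c : ℕ → 𝕜, c ∈ Set.pi Set.univ (fun _ : ℕ => Metric.closedBall (0 : 𝕜) L) ∧
        ‖x + (μ : 𝕜) • signedSum e (fun _ => (1 : 𝕜)) D - signedSum e c G₀‖ ≤ C * ‖x‖ := by
  have hs2 : s ^ 2 ≤ s := by nlinarith
  have hB'fin := hB.finite_large_coord x hs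
  have hG₀fin := hB.finite_large_coord x (show 0 < s * (μ / 2) by positivity)
  set B' := hB'fin.toFinset with hB'
  set G₀ := hG₀fin.toFinset with hG₀
  have memB' : ∀ i, i ∈ B' ↔ s ≤ ‖f i x‖ := fun i => by simp [hB']
  have memG₀ : ∀ i, i ∈ G₀ ↔ s * (μ / 2) ≤ ‖f i x‖ := fun i => by simp [hG₀]
  have hBB' : B ⊆ B' := fun i hi => (memB' i).2 (hs1.trans (hxB i hi))
  obtain ⟨κ, hκ, hf⟩ := hB.exists_bound
  -- The two bounds keep the moduli of the coordinates of `z` on `D` between `μ / 2` and `s ^ 2`.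
  obtain ⟨N₀, hN₀⟩ := hB.exists_forall_coord_lt x
    (show 0 < min (s * (μ / 2)) (s ^ 2 - μ) by
      refine lt_min (by positivity) (by linarith))
  refine ⟨G₀, κ * ‖x‖ + κ * (C * ‖x‖), N₀, ?_⟩
  intro D hD hDN hDa
  set z := x + (μ : 𝕜) • signedSum e (fun _ => (1 : 𝕜)) D with hz
  have hzD : ∀ i ∈ D, f i z = f i x + (μ : 𝕜) := by
    intro i hi
    rw [hz, map_add, map_smul, hB.coord_signedSum, if_pos hi, smul_eq_mul, mul_one]
  have hzD' : ∀ i ∉ D, f i z = f i x := by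
    intro i hi
    rw [hz, map_add, map_smul, hB.coord_signedSum, if_neg hi, smul_zero, add_zero]
  have hxD : ∀ i ∈ D, ‖f i x‖ < s * (μ / 2) ∧ ‖f i x‖ < s ^ 2 - μ := fun i hi =>
    lt_min_iff.1 (hN₀ i (hDN i hi))
  have hμn : ‖(μ : 𝕜)‖ = μ := by rw [RCLike.norm_ofReal, abs_of_pos hμ0]
  have hup : ∀ i ∈ D, ‖f i z‖ < s ^ 2 := by
    intro i hi
    rw [hzD i hi]
    have := norm_add_le (f i x) (μ : 𝕜)
    have := (hxD i hi).2
    linarith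
  have hlow : ∀ i ∈ D, μ / 2 ≤ ‖f i z‖ := by
    intro i hi
    have h1 := norm_sub_le (f i z) (f i x)
    rw [hzD i hi, add_sub_cancel_left, hμn, ← hzD i hi] at h1
    have h2 := (hxD i hi).1
    nlinarith
  have hDB' : ∀ i ∈ B', i ∉ D := by
    intro i hi hiD
    have h1 := (memB' i).1 hi
    have h2 := (hxD i hiD).2
    linarith
  obtain ⟨G, hGc, hG, y, hy, hle⟩ := hSG.exists_approx hC.le z
    (show 1 ≤ B'.card from (hBne.mono hBB').card_pos)
  -- If `G` missed a point of `B`, its coordinates would be at least `s`, hence off `D`, forcing `G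
  -- = B'`.
  have hBG : B ⊆ G := by
    intro j hj
    by_contra hjG
    have hsub' : G ⊆ B' := by
      intro i hi
      have h1 := hG i hi j hjG
      have hjz : 1 ≤ ‖f j z‖ := by rw [hzD' j (hDB' j (hBB' hj))]; exact hxB j hj
      have h2 : s ≤ ‖f i z‖ := by nlinarith
      have hiD : i ∉ D := fun hiD => by
        have := hup i hiD
        linarith
      rwa [hzD' i hiD, ← memB'] at h2
    exact hjG (Finset.eq_of_subset_of_card_le hsub' hGc.ge ▸ hBB' hj)
  -- A point of `D` in `G` would push some `j ∈ B'` out of `G`, and its coordinate would then be at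
  -- least `s * s`.
  have hGD : ∀ i ∈ G, i ∉ D := by
    intro i hi hiD
    obtain ⟨j, hjB', hjG⟩ : ∃ j ∈ B', j ∉ G := by
      by_contra! h
      exact hDB' i (Finset.eq_of_subset_of_card_le h hGc.le ▸ hi) hiD
    have h1 := hG i hi j hjG
    rw [hzD' j (hDB' j hjB')] at h1
    have h2 := (memB' j).1 hjB'
    have h3 := hup i hiD
    nlinarith
  have hGG₀ : G ⊆ G₀ := by
    intro i hi
    obtain ⟨j, hj⟩ := hD
    have h1 := hG i hi j fun hjG => hGD j hjG hj
    rw [hzD' i (hGD i hi)] at h1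
    have h2 := hlow j hj
    exact (memG₀ i).2 (by nlinarith)
  -- The competitor is `μ 1_D`, admissible since `w(D) ≤ w(B) ≤ w(G)`.
  have hzy : ‖z - y‖ ≤ C * ‖x‖ := by
    have := hle ((μ : 𝕜) • signedSum e (fun _ => (1 : 𝕜)) D)
    rw [← signedSum_smul] at this
    have h1 := this (D.finite_toSet.subset (hB.supp_signedSum_subset _ _))
      ((weight_mono (hB.supp_signedSum_subset _ _)).trans ((weight_coe_le_iff hw).2
        (hDa.trans (Finset.sum_le_sum_of_subset_of_nonneg hBG fun i _ _ => (hw i).le))))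
    rwa [signedSum_smul, hz, add_sub_cancel_right] at h1
  refine ⟨fun i => f i y, ?_, ?_⟩
  · rw [Set.mem_univ_pi]
    intro i
    rw [mem_closedBall_zero_iff]
    by_cases hi : i ∈ G
    · have h1 := hf i (z - y)
      rw [map_sub, hzD' i (hGD i hi)] at h1
      have h2 := norm_sub_le (f i x) (f i x - f i y)
      rw [sub_sub_cancel] at h2
      have h3 := hf i x
      have h4 : κ * ‖z - y‖ ≤ κ * (C * ‖x‖) := by gcongr
      linarith
    · have : f i y = 0 := by
        by_contra h0
        exact hi (hy h0)
      rw [this, norm_zero]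
      positivity
  · rw [← hB.eq_signedSum (hy.trans (Finset.coe_subset.2 hGG₀))]
    exact hzy

include hsub

/-- For a vector `x` whose coordinates on `B` are at least one, there are far away signed sums
over sets of weight comparable to that of `B` which are controlled by `x`. -/
theorem exists_signedSum_le (x : X) {B : Finset ℕ} (hBne : B.Nonempty)
    (hxB : ∀ i ∈ B, 1 ≤ ‖f i x‖) (N : ℕ) :
    ∃ (D : Finset ℕ) (ε : ℕ → 𝕜), D.Nonempty ∧ (∀ i ∈ D, N ≤ i) ∧ IsSign ε D ∧
      ∑ i ∈ B, w i < ∑ i ∈ D, w i ∧ ∑ i ∈ D, w i ≤ 2 * ∑ i ∈ B, w i ∧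
      ‖signedSum e ε D‖ ≤ 12 / 5 * C * s⁻¹ ^ 2 * ‖x‖ := by
  have hx0 : 0 < ‖x‖ := by
    rw [norm_pos_iff]
    rintro rfl
    obtain ⟨i, hi⟩ := hBne
    have := hxB i hi
    simp at this
    linarith
  set a := ∑ i ∈ B, w i with ha
  have ha0 : 0 < a := Finset.sum_pos (fun i _ => hw i) hBne
  -- Any `μ < s ^ 2` close to it works: here `(2 + 1/10) * 11/10 = 2.31 ≤ 12/5`.
  set μ : ℝ := 10 / 11 * s ^ 2 with hμ
  have hμ0 : 0 < μ := by positivity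
  have hμs : μ < s ^ 2 := by
    have : 0 < s ^ 2 := by positivity
    rw [hμ]; linarith
  obtain ⟨G₀, L, N₀, key⟩ :=
    exists_approx_add_sum hB hw hC hs hs1 hSG x hBne hxB hμ0 hμs
  have hex := fun n => exists_finset_weight hw hsub (max (max N N₀) n) ha0 (half_pos ha0)
  choose D hDne hDN hDlow hDup using hex
  choose c hcK hc using fun n => key (D n) (hDne n)
    (fun i hi => ((le_max_right _ _).trans (le_max_left _ _)).trans (hDN n i hi)) (hDup n)
  have hcomp : IsCompact ((fun c : ℕ → 𝕜 => signedSum e c G₀) ''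
      Set.pi Set.univ (fun _ : ℕ => Metric.closedBall (0 : 𝕜) L)) := by
    refine (isCompact_univ_pi fun _ => isCompact_closedBall _ _).image ?_
    unfold signedSum
    fun_prop
  obtain ⟨y, -, ψ, hψ, hlim⟩ := hcomp.tendsto_subseq
    (x := fun n => signedSum e (c n) G₀) fun n => ⟨c n, hcK n, rfl⟩
  obtain ⟨K, hK⟩ := Metric.cauchySeq_iff.1 hlim.cauchySeq (C * ‖x‖ / 10) (by positivity)
  set p := ψ K with hp
  -- Since `D q` starts no earlier than `q ≥ q'`, it lies entirely beyond `D p`.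
  set q' := max K ((D p).sup id + 1) with hq'
  set q := ψ q' with hq
  have hclose : ‖signedSum e (c p) G₀ - signedSum e (c q) G₀‖ < C * ‖x‖ / 10 := by
    rw [← dist_eq_norm]
    exact hK K le_rfl q' (le_max_left _ _)
  have hdisj : Disjoint (D p) (D q) := by
    rw [Finset.disjoint_left]
    intro i hi hiq
    have h1 : i ≤ (D p).sup id := Finset.le_sup (f := id) hi
    have h2 := (le_max_right _ _).trans (hDN q i hiq)
    have h3 : q' ≤ q := hψ.id_le q'
    have h4 : (D p).sup id + 1 ≤ q' := le_max_right _ _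
    omega
  refine ⟨D p ∪ D q, fun i => if i ∈ D p then 1 else -1, (hDne p).mono Finset.subset_union_left,
    ?_, IsSign.union (fun i _ => by simp) (fun i _ => by simp), ?_, ?_, ?_⟩
  · intro i hi
    rcases Finset.mem_union.1 hi with h | h
    · exact ((le_max_left _ _).trans (le_max_left _ _)).trans (hDN p i h)
    · exact ((le_max_left _ _).trans (le_max_left _ _)).trans (hDN q i h)
  · rw [Finset.sum_union hdisj]
    linarith [hDlow p, hDlow q]
  · rw [Finset.sum_union hdisj]
    linarith [hDup p, hDup q]
  · rw [signedSum_union (fun _ => 1) (fun _ => -1) hdisj]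
    have hneg : signedSum e (fun _ => (-1 : 𝕜)) (D q) = -signedSum e (fun _ => (1 : 𝕜)) (D q) := by
      simp [signedSum]
    rw [hneg, ← sub_eq_add_neg]
    set P := signedSum e (fun _ => (1 : 𝕜)) (D p)
    set Q := signedSum e (fun _ => (1 : 𝕜)) (D q)
    have h1 : ‖(μ : 𝕜) • (P - Q)‖ ≤ C * ‖x‖ + C * ‖x‖ + C * ‖x‖ / 10 := by
      have : (μ : 𝕜) • (P - Q) = (x + (μ : 𝕜) • P - signedSum e (c p) G₀)
          - (x + (μ : 𝕜) • Q - signedSum e (c q) G₀)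
          + (signedSum e (c p) G₀ - signedSum e (c q) G₀) := by
        rw [smul_sub]; abel
      rw [this]
      exact (norm_add_le _ _).trans (add_le_add ((norm_sub_le _ _).trans
        (add_le_add (hc p) (hc q))) hclose.le)
    rw [norm_smul, RCLike.norm_ofReal, abs_of_pos hμ0, hμ] at h1
    have h2 : 0 < C * ‖x‖ := by positivity
    have h3 : s ^ 2 * ‖P - Q‖ ≤ 12 / 5 * (C * ‖x‖) := by linarith
    have h4 : 12 / 5 * C * s⁻¹ ^ 2 * ‖x‖ = (12 / 5 * (C * ‖x‖)) / s ^ 2 := by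
      field_simp
    rw [h4, le_div_iff₀' (by positivity)]
    exact h3

/-- With `p = u = 1_{ε,A}` only the far away sum remains, and that is controlled by `x`. The slacks
multiply to `4/3 * 6/5 * 12/5 = 96/25 ≤ 4`. -/
theorem norm_signedSum_le (hM0 : 0 < M) (hM : BoundedWeightBlocksSeparate e f w M) {A : Finset ℕ} (hA : A.Nonempty) {ε : ℕ → 𝕜} (hε : IsSign ε A) (x : X)
    (hAx : weight w A ≤ weight w {i | 1 ≤ ‖f i x‖}) :
    ‖signedSum e ε A‖ ≤ 4 * s⁻¹ ^ 3 * C ^ 2 * M * ‖x‖ := by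
  have hfin := hB.finite_large_coord x one_pos
  set B := hfin.toFinset with hBdef
  have hxB : ∀ i ∈ B, 1 ≤ ‖f i x‖ := fun i hi => by simpa [hBdef] using hi
  have hBc : {i | 1 ≤ ‖f i x‖} = (B : Set ℕ) := hfin.coe_toFinset.symm
  rw [hBc, weight_coe_le_iff hw] at hAx
  have hA0 : 0 < ∑ i ∈ A, w i := Finset.sum_pos (fun i _ => hw i) hA
  have hBne : B.Nonempty := by
    by_contra h
    rw [Finset.not_nonempty_iff_eq_empty.1 h, Finset.sum_empty] at hAx
    linarith
  have hu : ∀ i, ‖f i (signedSum e ε A)‖ ≤ 1 := by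
    intro i
    rw [hB.coord_signedSum]
    split_ifs with h
    · exact (hε i h).le
    · simp
  have hβ : 1 / s < 6 / 5 * s⁻¹ := by
    rw [one_div]
    have := inv_pos.2 hs
    linarith
  obtain ⟨N, hN⟩ := exists_forall_norm_le hB hw hC hs hSG hsub hM0 hM (signedSum e ε A)
    zero_le_one hu hβ (2 * ∑ i ∈ B, w i) (show 0 < M / 3 by positivity)
  obtain ⟨D, ε', hD, hDN, hε', hD1, hD2, hle⟩ :=
    exists_signedSum_le hB hw hC hs hs1 hSG hsub x hBne hxB N
  have h1 := hN D hD hDN hD2 ε' hε' (signedSum e ε A)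
    (A.finite_toSet.subset (hB.supp_signedSum_subset _ _))
    ((weight_mono (hB.supp_signedSum_subset _ _)).trans
      ((weight_coe_le_iff hw).2 (hAx.trans hD1.le)))
  rw [sub_self, zero_add, norm_smul, RCLike.norm_ofReal, abs_of_pos (by positivity)] at h1
  calc ‖signedSum e ε A‖ ≤ (M + M / 3) * (C * (6 / 5 * s⁻¹ * ‖signedSum e ε' D‖)) := h1
    _ ≤ (M + M / 3) * (C * (6 / 5 * s⁻¹ * (12 / 5 * C * s⁻¹ ^ 2 * ‖x‖))) := by gcongr
    _ = 96 / 25 * (s⁻¹ ^ 3 * C ^ 2 * M * ‖x‖) := by ring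
    _ ≤ 4 * (s⁻¹ ^ 3 * C ^ 2 * M * ‖x‖) := by
      gcongr
      norm_num
    _ = 4 * s⁻¹ ^ 3 * C ^ 2 * M * ‖x‖ := by ring

end Estimates

theorem norm_sgn (a : 𝕜) : ‖sgn a‖ = 1 := by
  unfold sgn
  split_ifs with h
  · exact norm_one
  · rw [norm_div, RCLike.norm_ofReal, abs_norm, div_self (norm_ne_zero_iff.2 h)]

/-! ### Approximation inside the support and the thresholding estimates. -/

section Thresholding

variable (hB : IsMarkushevichBasis e f) (hw : ∀ i, 0 < w i) (hC : 0 < C) (hs : 0 < s) (hs1 : s ≤ 1)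
  (hSG : IsWeakSemiGreedy f w C s)
  (hsub : ∃ φ : ℕ → ℕ, StrictMono φ ∧ Tendsto (w ∘ φ) atTop (𝓝 0) ∧ ¬ Summable (w ∘ φ))
  (hM0 : 0 < M) (hM : BoundedWeightBlocksSeparate e f w M)

include hB hw hC hs hs1 hSG hsub hM0 hM

/-- Signed sums over sets of bounded weight are bounded. -/
theorem exists_norm_signedSum_le_of_weight_le (R : ℝ) :
    ∃ L : ℝ, 0 ≤ L ∧ ∀ D : Finset ℕ, D.Nonempty → ∑ i ∈ D, w i ≤ R →
      ‖signedSum e (fun _ => (1 : 𝕜)) D‖ ≤ L := by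
  obtain ⟨B, -, -, hBR, -⟩ := exists_finset_weight hw hsub 0
    (show 0 < max R 0 + 1 by positivity) one_pos
  refine ⟨_, by positivity, fun D hD hDR => norm_signedSum_le hB hw hC hs hs1 hSG hsub hM0 hM hD
    (fun i _ => norm_one) (signedSum e (fun _ => (1 : 𝕜)) B) ?_⟩
  calc weight w D ≤ weight w B := (weight_coe_le_iff hw).2 (by linarith [le_max_left R 0])
    _ ≤ _ := weight_mono fun i hi => by
      rw [Set.mem_ofPred_eq, hB.coord_signedSum, if_pos (Finset.mem_coe.1 hi), norm_one]

/-- Every vector is a limit of finitely supported vectors with smaller supports. -/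
theorem exists_finite_supp_subset_near (y : X) {ε : ℝ} (hε : 0 < ε) :
    ∃ g : X, (supp f g).Finite ∧ supp f g ⊆ supp f y ∧ ‖y - g‖ ≤ ε := by
  by_cases hS : (supp f y).Finite
  · exact ⟨y, hS, subset_rfl, by simpa using hε.le⟩
  replace hS : (supp f y).Infinite := hS
  -- The finitely supported `z` near `y` may leave `supp y`; it serves only as a competitor for `y +
  -- l 1_D`. The approximant `g` is read off a greedy set of that vector.
  set η := ε / (2 * C * (M + 1)) with hη
  have hη0 : 0 < η := by positivity
  obtain ⟨z, hzfin, hyz⟩ := hB.exists_finite_supp_near y hη0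
  set Z := hzfin.toFinset with hZ
  have hZc : supp f z = (Z : Set ℕ) := hzfin.coe_toFinset.symm
  set R := ∑ i ∈ Z, w i with hR
  have hR0 : 0 ≤ R := Finset.sum_nonneg fun i _ => (hw i).le
  obtain ⟨L, hL0, hL⟩ :=
    exists_norm_signedSum_le_of_weight_le hB hw hC hs hs1 hSG hsub hM0 hM (R + 1)
  set l := η / (L + 1) with hl
  have hl0 : 0 < l := by positivity
  have hlL : l * L ≤ η := by
    rw [hl, div_mul_eq_mul_div, div_le_iff₀ (by positivity)]
    nlinarith
  have hH₀fin := hB.finite_large_coord y (show 0 < s * (l / 2) by positivity)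
  set H₀ := hH₀fin.toFinset with hH₀
  have memH₀ : ∀ i, i ∈ H₀ ↔ s * (l / 2) ≤ ‖f i y‖ := fun i => by simp [hH₀]
  -- One index more than `|G \ D| = |H₀|`: some index of `I` is left out of `G`, so `G \ D` lies
  -- where the coordinates of `y` are at least `s * ρ`. This set is finite, inside `supp y`, and
  -- fixed before `D`, so `F` can be separated from `D`.
  obtain ⟨I, hIS, hIc⟩ := hS.exists_subset_card_eq (H₀.card + 1)
  obtain ⟨i₀, hi₀, hmin⟩ := I.exists_min_image (fun i => ‖f i y‖)
    (Finset.card_pos.1 (by omega))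
  set ρ := ‖f i₀ y‖ with hρ
  have hρ0 : 0 < ρ := norm_pos_iff.2 (hIS hi₀)
  have hHfin := hB.finite_large_coord y (show 0 < s * ρ by positivity)
  set F := Submodule.span 𝕜 ({y} ∪ e '' {i | s * ρ ≤ ‖f i y‖}) with hF
  have : FiniteDimensional 𝕜 F :=
    FiniteDimensional.span_of_finite 𝕜 ((Set.finite_singleton y).union (hHfin.image e))
  obtain ⟨N₁, hN₁⟩ := hM.exists_forall_le hM0 hB hw hsub F (R + 1) one_pos
  obtain ⟨N₂, hN₂⟩ := hB.exists_forall_coord_lt y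
    (show 0 < min (min (l / 2) (s * (l / 2))) ρ by positivity)
  obtain ⟨D, hD, hDN, hDlow, hDup⟩ := exists_finset_weight hw hsub (max N₁ N₂)
    (show 0 < R + 1 by linarith) one_pos
  rw [add_sub_cancel_right] at hDlow
  have hyD : ∀ i ∈ D, ‖f i y‖ < l / 2 ∧ ‖f i y‖ < s * (l / 2) ∧ ‖f i y‖ < ρ := by
    intro i hi
    have h := hN₂ i ((le_max_right _ _).trans (hDN i hi))
    rw [lt_min_iff, lt_min_iff] at h
    exact ⟨h.1.1, h.1.2, h.2⟩
  set x := y + (l : 𝕜) • signedSum e (fun _ => (1 : 𝕜)) D with hx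
  have hxD : ∀ i ∈ D, l / 2 ≤ ‖f i x‖ := by
    intro i hi
    have h1 : f i x = f i y + (l : 𝕜) := by
      rw [hx, map_add, map_smul, hB.coord_signedSum, if_pos hi, smul_eq_mul, mul_one]
    have h2 := norm_sub_le (f i x) (f i y)
    rw [h1, add_sub_cancel_left, ← h1, RCLike.norm_ofReal, abs_of_pos hl0] at h2
    linarith [(hyD i hi).1]
  have hxD' : ∀ i ∉ D, f i x = f i y := by
    intro i hi
    rw [hx, map_add, map_smul, hB.coord_signedSum, if_neg hi, smul_zero, add_zero]
  have hDH₀ : Disjoint D H₀ := Finset.disjoint_left.2 fun i hi h =>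
    absurd ((memH₀ i).1 h) (not_le.2 (hyD i hi).2.1)
  obtain ⟨G, hGc, hG, y', hy', hle⟩ := hSG.exists_approx hC.le x
    (show 1 ≤ (D ∪ H₀).card from (hD.mono Finset.subset_union_left).card_pos)
  have hDG : D ⊆ G := by
    intro j hj
    by_contra hjG
    have hsub' : G ⊆ D ∪ H₀ := by
      intro i hi
      rw [Finset.mem_union]
      by_cases hiD : i ∈ D
      · exact Or.inl hiD
      · refine Or.inr ((memH₀ i).2 ?_)
        rw [← hxD' i hiD]
        refine le_trans ?_ (hG i hi j hjG)
        have := hxD j hj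
        gcongr
    exact hjG (Finset.eq_of_subset_of_card_le hsub' hGc.ge ▸ Finset.mem_union_left _ hj)
  have hGDH : ∀ i ∈ G \ D, s * ρ ≤ ‖f i y‖ := by
    intro i hi
    obtain ⟨hiG, hiD⟩ := Finset.mem_sdiff.1 hi
    obtain ⟨j, hjI, hjG⟩ : ∃ j ∈ I, j ∉ G := by
      by_contra! h
      have h1 : I ⊆ G \ D := fun j hj => Finset.mem_sdiff.2 ⟨h j hj, fun hjD =>
        absurd (hmin j hj) (not_le.2 (hyD j hjD).2.2)⟩
      have h2 := Finset.card_le_card h1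
      rw [Finset.card_sdiff_of_subset hDG, hGc, Finset.card_union_of_disjoint hDH₀] at h2
      omega
    rw [← hxD' i hiD]
    refine le_trans ?_ (hG i hiG j hjG)
    rw [hxD' j fun h => hjG (hDG h)]
    have := hmin j hjI
    gcongr
  set g := signedSum e (fun i => f i y') (G \ D) with hg
  have hyg : y' = g + signedSum e (fun i => f i y') D := by
    conv_lhs => rw [hB.eq_signedSum hy']
    exact (Finset.sum_sdiff hDG).symm
  refine ⟨g, (G \ D).finite_toSet.subset (hB.supp_signedSum_subset _ _), ?_, ?_⟩
  · refine (hB.supp_signedSum_subset _ _).trans fun i hi => ?_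
    have h1 := hGDH i (Finset.mem_coe.1 hi)
    have h2 : 0 < s * ρ := by positivity
    exact norm_pos_iff.1 (h2.trans_le h1)
  · have h1 := hN₁ D (fun i hi => (le_max_left _ _).trans (hDN i hi)) hDup
      ((l : 𝕜) • (fun _ => (1 : 𝕜)) + (-1 : 𝕜) • fun i => f i y') (y - g)
      (Submodule.sub_mem _ (Submodule.subset_span (Or.inl rfl))
        (Submodule.span_mono Set.subset_union_right (signedSum_mem_span _ hGDH)))
    have h2 : y - g + signedSum e ((l : 𝕜) • (fun _ => (1 : 𝕜)) + (-1 : 𝕜) • fun i => f i y') D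
        = x - y' := by
      rw [signedSum_add, signedSum_smul, signedSum_smul, neg_one_smul]
      conv_rhs => rw [hyg]
      rw [hx]
      abel
    rw [h2] at h1
    have h3 := hle z hzfin (by
      rw [hZc, weight_coe_le_iff hw]
      exact hDlow.le.trans (Finset.sum_le_sum_of_subset_of_nonneg hDG fun i _ _ => (hw i).le))
    have h4 : ‖x - z‖ ≤ 2 * η := by
      have h5 : x - z = (y - z) + (l : 𝕜) • signedSum e (fun _ => (1 : 𝕜)) D := by
        rw [hx]; abel
      rw [h5]
      refine (norm_add_le _ _).trans ?_
      rw [norm_smul, RCLike.norm_ofReal, abs_of_pos hl0]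
      have h6 : l * ‖signedSum e (fun _ => (1 : 𝕜)) D‖ ≤ l * L := by
        gcongr
        exact hL D hD hDup
      linarith
    calc ‖y - g‖ ≤ (M + 1) * (C * ‖x - z‖) := h1.trans (by gcongr)
      _ ≤ (M + 1) * (C * (2 * η)) := by gcongr
      _ = ε := by rw [hη]; field_simp

/-- The greedy bound for approximants of finite support. -/
theorem norm_sub_proj_le_of_finite (x : X) {t : ℝ} (ht : 0 < t) {A : Finset ℕ}
    (hA : IsGreedySet f t x A) (y : X) (hyfin : (supp f y).Finite)
    (hwy : weight w (supp f y) ≤ weight w A) (hyA : Disjoint (supp f y) (A : Set ℕ)) :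
    ‖x - proj e f A x‖ ≤ C * M * (1 + 6 * C * t⁻¹ * s⁻¹ ^ 3) * ‖x - y‖ := by
  have hC1 := hSG.one_le hC.le hB
  have hM1 := hM.one_le hM0 hB hw hsub
  set Q := C * t⁻¹ * s⁻¹ ^ 3 with hQ
  have hQ0 : 0 < Q := by positivity
  have hK : C * M * (1 + 6 * C * t⁻¹ * s⁻¹ ^ 3) = C * M * (1 + 6 * Q) := by rw [hQ]; ring
  rw [hK]
  rcases A.eq_empty_or_nonempty with rfl | hAne
  · have hy0 : y = 0 := by
      set Y := hyfin.toFinset with hY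
      have hYc : supp f y = (Y : Set ℕ) := hyfin.coe_toFinset.symm
      rw [hYc, weight_coe_le_iff hw, Finset.sum_empty] at hwy
      refine hB.total y fun i => ?_
      by_contra hi
      have hiY : i ∈ Y := by
        rw [← Finset.mem_coe, ← hYc]
        exact hi
      have := Finset.sum_pos (fun i _ => hw i) ⟨i, hiY⟩
      linarith
    rw [hy0, proj, Finset.sum_empty, sub_zero]
    -- For empty `A` the estimate is `‖x‖ ≤ K ‖x‖`, which needs `1 ≤ C` and `1 ≤ M`.
    have : 1 ≤ C * M * (1 + 6 * Q) :=
      one_le_mul_of_one_le_of_one_le (one_le_mul_of_one_le_of_one_le hC1 hM1) (by linarith)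
    exact le_mul_of_one_le_left (norm_nonneg _) this
  obtain ⟨i₀, hi₀, hmin⟩ := A.exists_min_image (fun i => ‖f i x‖) hAne
  set α := ‖f i₀ x‖ with hα
  have hout : ∀ j ∉ A, ‖f j x‖ ≤ α / t := fun j hj => by
    rw [le_div_iff₀' ht]
    exact hA i₀ hi₀ j hj
  rcases (norm_nonneg (f i₀ x)).eq_or_lt with h0 | hα0
  · have hsupp : supp f x ⊆ A := by
      intro j hj
      by_contra hjA
      have h1 := hout j hjA
      rw [hα, ← h0, zero_div] at h1
      exact hj (norm_le_zero_iff.1 h1)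
    have : x - proj e f A x = 0 := sub_eq_zero.2 (hB.eq_signedSum hsupp)
    rw [this, norm_zero]
    positivity
  rw [← hα] at hα0
  have hPcoord : ∀ i, f i (proj e f A x) = if i ∈ A then f i x else 0 :=
    fun i => hB.coord_signedSum (fun i => f i x) A i
  have hu : ∀ i, ‖f i (x - proj e f A x)‖ ≤ α / t := by
    intro i
    rw [map_sub, hPcoord]
    split_ifs with hi
    · rw [sub_self, norm_zero]
      positivity
    · rw [sub_zero]
      exact hout i hi
  have hβ : α / t / s < 6 / 5 * (α / t / s) := by
    have : 0 < α / t / s := by positivity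
    linarith
  -- far away signed sums controlled by `x - y`
  have hyA0 : ∀ i ∈ A, f i y = 0 := fun i hi => by
    by_contra h
    exact Set.disjoint_left.1 hyA h (Finset.mem_coe.2 hi)
  have hscaled : ∀ i ∈ A, 1 ≤ ‖f i ((α : 𝕜)⁻¹ • (x - y))‖ := by
    intro i hi
    rw [map_smul, map_sub, hyA0 i hi, sub_zero, norm_smul, norm_inv, RCLike.norm_ofReal,
      abs_of_pos hα0, ← div_eq_inv_mul, le_div_iff₀ hα0, one_mul]
    exact hmin i hi
  have hscale : ‖(α : 𝕜)⁻¹ • (x - y)‖ = α⁻¹ * ‖x - y‖ := by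
    rw [norm_smul, norm_inv, RCLike.norm_ofReal, abs_of_pos hα0]
  have hfin : ∀ δ > 0, ‖x - proj e f A x‖ ≤ (M + δ) * (C * ((1 + 6 * Q) * ‖x - y‖)) := by
    intro δ hδ
    -- The subtracted vector `y - P_A x` may have support of weight up to `2 w(A)`, so two far away
    -- sets are needed, each of weight in `(w(A), 2 w(A)]`. Hence the factor `2 * 6/5 * 12/5 =
    -- 144/25 ≤ 6`.
    obtain ⟨N, hN⟩ := exists_forall_norm_le hB hw hC hs hSG hsub hM0 hM (x - proj e f A x)
      (by positivity) hu hβ (4 * ∑ i ∈ A, w i) hδ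
    obtain ⟨D₁, ε₁, hD₁, hD₁N, hε₁, hlow₁, hup₁, hle₁⟩ :=
      exists_signedSum_le hB hw hC hs hs1 hSG hsub _ hAne hscaled N
    obtain ⟨D₂, ε₂, hD₂, hD₂N, hε₂, hlow₂, hup₂, hle₂⟩ :=
      exists_signedSum_le hB hw hC hs hs1 hSG hsub _ hAne hscaled (max N (D₁.sup id + 1))
    have hdisj : Disjoint D₁ D₂ := by
      rw [Finset.disjoint_left]
      intro i hi hi2
      have h1 : i ≤ D₁.sup id := Finset.le_sup (f := id) hi
      have h2 := (le_max_right _ _).trans (hD₂N i hi2)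
      omega
    have hpsub : supp f (y - proj e f A x) ⊆ supp f y ∪ A := by
      intro i hi
      by_contra h
      simp only [Set.mem_union, not_or, Finset.mem_coe] at h
      refine hi ?_
      rw [map_sub, hPcoord, if_neg h.2, sub_zero]
      by_contra h1
      exact h.1 h1
    have h1 := hN (D₁ ∪ D₂) (hD₁.mono Finset.subset_union_left)
      (fun i hi => (Finset.mem_union.1 hi).elim (hD₁N i)
        fun h => (le_max_left _ _).trans (hD₂N i h))
      (by rw [Finset.sum_union hdisj]; linarith) _ (hε₁.union hε₂) (y - proj e f A x)
      ((hyfin.union A.finite_toSet).subset hpsub) (by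
        refine (weight_mono hpsub).trans ?_
        set Y := hyfin.toFinset with hY
        have hYc : supp f y = (Y : Set ℕ) := hyfin.coe_toFinset.symm
        rw [hYc, weight_coe_le_iff hw] at hwy
        rw [hYc] at hyA ⊢
        rw [← Finset.coe_union, weight_coe_le_iff hw, Finset.sum_union hdisj,
          Finset.sum_union (Finset.disjoint_coe.1 hyA)]
        linarith)
    rw [signedSum_union _ _ hdisj, sub_sub_sub_cancel_right] at h1
    refine h1.trans ?_
    gcongr
    refine (norm_add_le _ _).trans ?_
    rw [norm_smul, RCLike.norm_ofReal, abs_of_pos (by positivity)]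
    rw [hscale] at hle₁ hle₂
    have h2 := (norm_add_le (signedSum e ε₁ D₁) (signedSum e ε₂ D₂)).trans (add_le_add hle₁ hle₂)
    calc ‖x - y‖ + 6 / 5 * (α / t / s) * ‖signedSum e ε₁ D₁ + signedSum e ε₂ D₂‖
        ≤ ‖x - y‖ + 6 / 5 * (α / t / s) * (12 / 5 * C * s⁻¹ ^ 2 * (α⁻¹ * ‖x - y‖)
          + 12 / 5 * C * s⁻¹ ^ 2 * (α⁻¹ * ‖x - y‖)) := by gcongr
      _ = ‖x - y‖ + 144 / 25 * Q * ‖x - y‖ := by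
        rw [hQ]
        field_simp
        ring
      _ ≤ (1 + 6 * Q) * ‖x - y‖ := by
        have : 0 ≤ Q * ‖x - y‖ := by positivity
        linarith
  have hlim : Tendsto (fun δ : ℝ => (M + δ) * (C * ((1 + 6 * Q) * ‖x - y‖))) (𝓝[>] 0)
      (𝓝 ((M + 0) * (C * ((1 + 6 * Q) * ‖x - y‖)))) :=
    (((continuous_const.add continuous_id).mul continuous_const).tendsto 0).mono_left
      nhdsWithin_le_nhds
  have := ge_of_tendsto hlim (eventually_mem_nhdsWithin.mono hfin)
  calc ‖x - proj e f A x‖ ≤ _ := this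
    _ = _ := by ring

theorem norm_sub_proj_le (x : X) {t : ℝ} (ht : 0 < t) {A : Finset ℕ}
    (hA : IsGreedySet f t x A) (y : X) (hwy : weight w (supp f y) ≤ weight w A)
    (hyA : Disjoint (supp f y) (A : Set ℕ)) :
    ‖x - proj e f A x‖ ≤ C * M * (1 + 6 * C * t⁻¹ * s⁻¹ ^ 3) * ‖x - y‖ := by
  set K := C * M * (1 + 6 * C * t⁻¹ * s⁻¹ ^ 3) with hK
  have hK0 : 0 < K := by positivity
  refine le_of_forall_pos_le_add fun ε hε => ?_
  obtain ⟨g, hgfin, hgy, hyg⟩ := exists_finite_supp_subset_near hB hw hC hs hs1 hSG hsub hM0 hM y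
    (div_pos hε hK0)
  have h1 := norm_sub_proj_le_of_finite hB hw hC hs hs1 hSG hsub hM0 hM x ht hA g hgfin
    ((weight_mono hgy).trans hwy) (hyA.mono_left hgy)
  have h2 : ‖x - g‖ ≤ ‖x - y‖ + ε / K := by
    rw [← sub_add_sub_cancel x y g]
    exact (norm_add_le _ _).trans (by gcongr)
  calc ‖x - proj e f A x‖ ≤ K * ‖x - g‖ := h1
    _ ≤ K * (‖x - y‖ + ε / K) := by gcongr
    _ = K * ‖x - y‖ + ε := by field_simp

/-- Removing the common part `P_{A ∩ B} x` makes the supports disjoint: the greedy bound applies to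
`A \ B` and `y = P_{B \ A} x`, and the weight of `A ∩ B` cancels. -/
theorem isWeightAlmostGreedy :
    IsWeightAlmostGreedy e f w (C * M * (1 + 6 * C * s⁻¹ ^ 3)) := by
  intro x A hA
  have hK0 : 0 ≤ C * M * (1 + 6 * C * s⁻¹ ^ 3) := by positivity
  have : Nonempty {B : Finset ℕ // weight w B ≤ weight w A} := ⟨⟨A, le_rfl⟩⟩
  rw [Real.mul_iInf_of_nonneg hK0]
  refine le_ciInf ?_
  rintro ⟨B, hBA⟩
  rw [weight_coe_le_iff hw] at hBA
  have hPcoord : ∀ (S : Finset ℕ) i, f i (proj e f S x) = if i ∈ S then f i x else 0 :=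
    fun S i => hB.coord_signedSum (fun i => f i x) S i
  set x' := x - proj e f (A ∩ B) x with hx'
  have hx'c : ∀ i, f i x' = if i ∈ A ∩ B then 0 else f i x := by
    intro i
    rw [hx', map_sub, hPcoord]
    split_ifs <;> simp
  have hA' : IsGreedySet f 1 x' (A \ B) := by
    intro i hi j hj
    obtain ⟨hiA, hiB⟩ := Finset.mem_sdiff.1 hi
    rw [hx'c, hx'c, if_neg fun h => hiB (Finset.mem_inter.1 h).2]
    split_ifs with hjAB
    · simp
    · exact hA i hiA j fun hjA => hj (Finset.mem_sdiff.2 ⟨hjA, fun hjB =>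
        hjAB (Finset.mem_inter.2 ⟨hjA, hjB⟩)⟩)
  have hproj : proj e f (A \ B) x' = proj e f (A \ B) x :=
    signedSum_congr fun i hi => by
      rw [hx'c, if_neg fun h => (Finset.mem_sdiff.1 hi).2 (Finset.mem_inter.1 h).2]
  have hsupp : supp f (proj e f (B \ A) x) ⊆ ((B \ A : Finset ℕ) : Set ℕ) :=
    hB.supp_signedSum_subset _ _
  have h1 := norm_sub_proj_le hB hw hC hs hs1 hSG hsub hM0 hM x' one_pos hA'
    (proj e f (B \ A) x) (by
      refine (weight_mono hsupp).trans ((weight_coe_le_iff hw).2 ?_)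
      have h2 := Finset.sum_sdiff (f := w) (Finset.inter_subset_left : A ∩ B ⊆ A)
      have h3 := Finset.sum_sdiff (f := w) (Finset.inter_subset_right : A ∩ B ⊆ B)
      rw [Finset.sdiff_inter_self_left] at h2
      rw [Finset.sdiff_inter_self_right] at h3
      linarith)
    (Set.disjoint_of_subset_left hsupp
      (Finset.disjoint_coe.2 (Finset.disjoint_sdiff.mono_left Finset.sdiff_subset)))
  have h2 : x' - proj e f (A \ B) x' = x - proj e f A x := by
    rw [hproj, hx', sub_sub]
    congr 1
    rw [add_comm]
    have := Finset.sum_sdiff (f := fun i => f i x • e i) (Finset.inter_subset_left : A ∩ B ⊆ A)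
    rwa [Finset.sdiff_inter_self_left] at this
  have h3 : x' - proj e f (B \ A) x = x - proj e f B x := by
    rw [hx', sub_sub]
    congr 1
    rw [add_comm]
    have := Finset.sum_sdiff (f := fun i => f i x • e i) (Finset.inter_subset_right : A ∩ B ⊆ B)
    rwa [Finset.sdiff_inter_self_right] at this
  rw [h2, h3, inv_one, mul_one] at h1
  exact h1

theorem isWeightSuperdemocratic :
    IsWeightSuperdemocratic 𝕜 e w (4 * s⁻¹ ^ 3 * C ^ 2 * M) := by
  intro A B hAB ε ε' hε hε'
  rcases A.eq_empty_or_nonempty with rfl | hA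
  · rw [signedSum, Finset.sum_empty, norm_zero]
    positivity
  · refine norm_signedSum_le hB hw hC hs hs1 hSG hsub hM0 hM hA hε _ (hAB.trans (weight_mono ?_))
    intro i hi
    rw [Set.mem_ofPred_eq, hB.coord_signedSum, if_pos (Finset.mem_coe.1 hi),
      hε' i (Finset.mem_coe.1 hi)]

theorem isTruncationQuasiGreedy :
    IsTruncationQuasiGreedy e f (4 * s⁻¹ ^ 3 * C ^ 2 * M) := by
  intro x A hA
  set a := A.inf' hA fun i => ‖f i x‖ with ha
  have hle : ∀ i ∈ A, a ≤ ‖f i x‖ := fun i hi => Finset.inf'_le _ hi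
  rcases le_or_gt a 0 with h0 | h0
  · exact (mul_nonpos_of_nonpos_of_nonneg h0 (norm_nonneg _)).trans (by positivity)
  · have h1 := norm_signedSum_le hB hw hC hs hs1 hSG hsub hM0 hM hA
      (ε := fun i => sgn (f i x)) (fun i _ => norm_sgn _) ((a : 𝕜)⁻¹ • x) (weight_mono (by
        intro i hi
        rw [Set.mem_ofPred_eq, map_smul, norm_smul, norm_inv, RCLike.norm_ofReal, abs_of_pos h0,
          ← div_eq_inv_mul, le_div_iff₀ h0, one_mul]
        exact hle i hi))
    rw [norm_smul, norm_inv, RCLike.norm_ofReal, abs_of_pos h0] at h1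
    calc a * ‖signedSum e (fun i => sgn (f i x)) A‖
        ≤ a * (4 * s⁻¹ ^ 3 * C ^ 2 * M * (a⁻¹ * ‖x‖)) := by gcongr
      _ = 4 * s⁻¹ ^ 3 * C ^ 2 * M * ‖x‖ := by field_simp

theorem thresholdingEstimates : ThresholdingEstimates e f w C s M where
  greedy_bound x _ ht _ _ hA y hwy hyA :=
    norm_sub_proj_le hB hw hC hs hs1 hSG hsub hM0 hM x ht hA y hwy hyA
  almostGreedy := isWeightAlmostGreedy hB hw hC hs hs1 hSG hsub hM0 hM
  signedSum_bound _ hA _ hε x hAx := norm_signedSum_le hB hw hC hs hs1 hSG hsub hM0 hM hA hε x hAx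
  superdemocratic := isWeightSuperdemocratic hB hw hC hs hs1 hSG hsub hM0 hM
  truncationQuasiGreedy := isTruncationQuasiGreedy hB hw hC hs hs1 hSG hsub hM0 hM

end Thresholding

/-! ### Norming dual bases: basic sequences and Mazur's argument. -/

/-- Grunblum's criterion, for a sequence with biorthogonal functionals. -/
theorem isBasicSequenceWith_of_le {u : ℕ → X} {g : ℕ → StrongDual 𝕜 X}
    (hg : ∀ i j, g i (u j) = if i = j then 1 else 0) {K : ℝ} (hK : 0 ≤ K)
    (h : ∀ n, ∀ p ∈ Submodule.span 𝕜 (u '' Set.Iio n), ∀ z ∈ Submodule.span 𝕜 (u '' Set.Ici n),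
      ‖p‖ ≤ K * ‖p + z‖) :
    IsBasicSequenceWith 𝕜 u K := by
  set S := Submodule.span 𝕜 (Set.range u) with hS
  let P : ℕ → X →L[𝕜] X := fun n => ∑ i ∈ Finset.range n, (g i).smulRight (u i)
  have hP : ∀ n x, P n x = ∑ i ∈ Finset.range n, g i x • u i := fun n x => by
    simp [P, sum_apply]
  have hPu : ∀ n j, P n (u j) = if j < n then u j else 0 := fun n j => by
    simp [hP, hg]
  have hmem : ∀ n x, P n x ∈ Submodule.span 𝕜 (u '' Set.Iio n) := fun n x => by
    rw [hP]
    exact Submodule.sum_mem _ fun i hi => Submodule.smul_mem _ _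
      (Submodule.subset_span ⟨i, Finset.mem_range.1 hi, rfl⟩)
  have htail : ∀ n, ∀ x ∈ S, x - P n x ∈ Submodule.span 𝕜 (u '' Set.Ici n) := by
    intro n x hx
    induction hx using Submodule.span_induction with
    | mem x hx =>
      obtain ⟨j, rfl⟩ := hx
      rw [hPu]
      split_ifs with hj
      · simp
      · rw [sub_zero]
        exact Submodule.subset_span ⟨j, not_lt.1 hj, rfl⟩
    | zero => simp
    | add x y _ _ hx hy =>
      rw [map_add, add_sub_add_comm]
      exact add_mem hx hy
    | smul a x _ hx =>
      rw [map_smul, ← smul_sub]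
      exact Submodule.smul_mem _ _ hx
  have hbound : ∀ n, ∀ x ∈ S.topologicalClosure, ‖P n x‖ ≤ K * ‖x‖ := by
    intro n x hx
    have hcl : IsClosed {x : X | ‖P n x‖ ≤ K * ‖x‖} :=
      isClosed_le (P n).continuous.norm (continuous_const.mul continuous_norm)
    refine closure_minimal (fun y hy => ?_) hcl hx
    have := h n (P n y) (hmem n y) (y - P n y) (htail n y hy)
    rwa [add_sub_cancel] at this
  have hev : ∀ x ∈ S, ∀ᶠ n in atTop, P n x = x := by
    intro x hx
    induction hx using Submodule.span_induction with
    | mem x hx =>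
      obtain ⟨j, rfl⟩ := hx
      filter_upwards [eventually_gt_atTop j] with n hn
      rw [hPu, if_pos hn]
    | zero => simp
    | add x y _ _ hx hy =>
      filter_upwards [hx, hy] with n h1 h2
      rw [map_add, h1, h2]
    | smul a x _ hx =>
      filter_upwards [hx] with n h1
      rw [map_smul, h1]
  -- Uniform boundedness on the closure carries over the convergence from the span, where the
  -- partial sums are eventually constant.
  have hlim : ∀ x ∈ S.topologicalClosure, Tendsto (fun n => P n x) atTop (𝓝 x) := by
    intro x hx
    rw [Metric.tendsto_atTop]
    intro ε hε
    obtain ⟨y, hy, hxy⟩ := Metric.mem_closure_iff.1 hx (ε / (K + 2)) (by positivity)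
    obtain ⟨N, hN⟩ := eventually_atTop.1 (hev y hy)
    refine ⟨N, fun n hn => ?_⟩
    rw [dist_eq_norm] at hxy ⊢
    have h1 := hbound n (x - y) (sub_mem hx (S.le_topologicalClosure hy))
    rw [map_sub, hN n hn] at h1
    have h2 : P n x - x = (P n x - y) - (x - y) := by abel
    rw [h2]
    calc ‖P n x - y - (x - y)‖ ≤ K * ‖x - y‖ + ‖x - y‖ := (norm_sub_le _ _).trans (by gcongr)
      _ = (K + 1) * ‖x - y‖ := by ring
      _ ≤ (K + 1) * (ε / (K + 2)) := by gcongr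
      _ < ε := by
        rw [← mul_div_assoc, div_lt_iff₀ (by positivity)]
        nlinarith
  have huS : ∀ i, u i ∈ S.topologicalClosure := fun i =>
    S.le_topologicalClosure (Submodule.subset_span ⟨i, rfl⟩)
  let b : SchauderBasis 𝕜 S.topologicalClosure :=
    { basis := fun i => ⟨u i, huS i⟩
      coord := fun i => (g i).comp S.topologicalClosure.subtypeL
      ortho := fun i j => by
        simp [hg, Pi.single_apply]
      expansion := fun x => by
        rw [HasSum, SummationFilter.conditional_filter_eq_map_range, tendsto_map'_iff,
          tendsto_subtype_rng]
        refine (hlim x x.2).congr fun n => ?_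
        simp [hP] }
  refine ⟨b, fun k => rfl, fun n => ContinuousLinearMap.opNorm_le_bound _ hK fun x => ?_⟩
  have h1 : ((SchauderBasis.proj b n x : S.topologicalClosure) : X) = P n x := by
    simp [b, hP]
  rw [Submodule.coe_norm, h1]
  exact hbound n x x.2

theorem IsNorming.exists_lt {r : ℝ} (hf : IsNorming r f) {ρ : ℝ} (hρ0 : 0 ≤ ρ) (hρ : ρ < r)
    {x : X} (hx : x ≠ 0) :
    ∃ g ∈ Submodule.span 𝕜 (Set.range f), ‖g‖ = 1 ∧ ρ * ‖x‖ < ‖g x‖ := by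
  have h1 : ρ * ‖x‖ < ⨆ g : {g : StrongDual 𝕜 X //
      g ∈ Submodule.span 𝕜 (Set.range f) ∧ ‖g‖ = 1}, ‖g.1 x‖ :=
    (mul_lt_mul_of_pos_right hρ (norm_pos_iff.2 hx)).trans_le (hf x)
  rcases isEmpty_or_nonempty {g : StrongDual 𝕜 X //
      g ∈ Submodule.span 𝕜 (Set.range f) ∧ ‖g‖ = 1} with hE | hE
  -- A real supremum over an empty type is `0`, which `0 ≤ ρ` excludes.
  · rw [Real.iSup_of_isEmpty] at h1
    exact absurd h1 (not_lt.2 (by positivity))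
  · obtain ⟨⟨g, hg, hg1⟩, h2⟩ := exists_lt_of_lt_ciSup h1
    exact ⟨g, hg, hg1, h2⟩

/-- A functional in the span of the dual basis vanishes on the tails of the basis. -/
theorem IsMarkushevichBasis.exists_vanish (hB : IsMarkushevichBasis e f) {g : StrongDual 𝕜 X}
    (hg : g ∈ Submodule.span 𝕜 (Set.range f)) : ∃ N, ∀ i, N ≤ i → g (e i) = 0 := by
  induction hg using Submodule.span_induction with
  | mem g hg =>
    obtain ⟨j, rfl⟩ := hg
    exact ⟨j + 1, fun i hi => by rw [hB.biorthogonal, if_neg (by omega)]⟩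
  | zero => exact ⟨0, fun i _ => rfl⟩
  | add g g' _ _ h h' =>
    obtain ⟨N, hN⟩ := h
    obtain ⟨N', hN'⟩ := h'
    refine ⟨max N N', fun i hi => ?_⟩
    rw [add_apply, hN i ((le_max_left _ _).trans hi), hN' i ((le_max_right _ _).trans hi),
      add_zero]
  | smul a g _ h =>
    obtain ⟨N, hN⟩ := h
    exact ⟨N, fun i hi => by rw [smul_apply, hN i hi, smul_zero]⟩

/-- Mazur's argument: the tails of the basis are separated from finite dimensional subspaces. -/
theorem IsNorming.exists_forall_le {r : ℝ} (hf : IsNorming r f) (hr : 0 < r)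
    (hB : IsMarkushevichBasis e f) (F : Submodule 𝕜 X) [FiniteDimensional 𝕜 F] {K : ℝ}
    (hK : r⁻¹ < K) :
    ∃ N, ∀ x ∈ F, ∀ z ∈ (Submodule.span 𝕜 (e '' Set.Ici N)).topologicalClosure,
      ‖x‖ ≤ K * ‖x + z‖ := by
  have hK0 : 0 < K := (inv_pos.2 hr).trans hK
  have hρ : K⁻¹ < r := inv_lt_of_inv_lt₀ hr hK
  have hcomp : IsCompact ((↑) '' Metric.sphere (0 : F) 1 : Set X) := by
    have : ProperSpace F := FiniteDimensional.proper 𝕜 F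
    exact (isCompact_sphere _ _).image continuous_subtype_val
  have hmono : ∀ {N N' : ℕ}, N ≤ N' →
      (Submodule.span 𝕜 (e '' Set.Ici N')).topologicalClosure ≤
        (Submodule.span 𝕜 (e '' Set.Ici N)).topologicalClosure := fun h =>
    Submodule.topologicalClosure_mono (Submodule.span_mono
      (Set.image_mono (Set.Ici_subset_Ici.2 h)))
  obtain ⟨N, hN⟩ : ∃ N, ∀ x ∈ ((↑) '' Metric.sphere (0 : F) 1 : Set X),
      ∀ z ∈ (Submodule.span 𝕜 (e '' Set.Ici N)).topologicalClosure, K⁻¹ ≤ ‖x + z‖ := by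
    -- Near each unit vector a single norm-one functional exceeds `K⁻¹` in modulus and kills a tail;
    -- compactness leaves finitely many tails, and the shortest serves for all.
    refine hcomp.induction_on (p := fun s => ∃ N, ∀ x ∈ s,
      ∀ z ∈ (Submodule.span 𝕜 (e '' Set.Ici N)).topologicalClosure, K⁻¹ ≤ ‖x + z‖)
      ⟨0, by simp⟩ ?_ ?_ ?_
    · rintro s t hst ⟨N, hN⟩
      exact ⟨N, fun x hx => hN x (hst hx)⟩
    · rintro s t ⟨N, hN⟩ ⟨N', hN'⟩
      refine ⟨max N N', fun x hx z hz => ?_⟩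
      rcases hx with hx | hx
      · exact hN x hx z (hmono (le_max_left _ _) hz)
      · exact hN' x hx z (hmono (le_max_right _ _) hz)
    · rintro _ ⟨x, hx, rfl⟩
      have hx1 : ‖(x : X)‖ = 1 := by simpa using hx
      obtain ⟨g, hg, hg1, hgx⟩ := hf.exists_lt (inv_nonneg.2 hK0.le) hρ
        (show (x : X) ≠ 0 from norm_ne_zero_iff.1 (by rw [hx1]; exact one_ne_zero))
      rw [hx1, mul_one] at hgx
      obtain ⟨N, hN⟩ := hB.exists_vanish hg
      refine ⟨{y | K⁻¹ < ‖g y‖}, mem_nhdsWithin_of_mem_nhds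
        ((isOpen_lt continuous_const g.continuous.norm).mem_nhds hgx), N, fun y hy z hz => ?_⟩
      have hgz : g z = 0 := by
        have hcl : IsClosed {z : X | g z = 0} := isClosed_eq g.continuous continuous_const
        refine closure_minimal (fun z hz => ?_) hcl hz
        have hle : Submodule.span 𝕜 (e '' Set.Ici N) ≤ LinearMap.ker (g : X →ₗ[𝕜] 𝕜) := by
          rw [Submodule.span_le]
          rintro _ ⟨i, hi, rfl⟩
          exact hN i hi
        exact hle hz
      have h1 := g.le_opNorm (y + z)
      rw [hg1, one_mul, map_add, hgz, add_zero] at h1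
      exact (le_of_lt hy).trans h1
  refine ⟨N, fun x hx z hz => ?_⟩
  rcases eq_or_ne x 0 with rfl | hx0
  · rw [norm_zero]
    positivity
  · have hn : ‖x‖ ≠ 0 := norm_ne_zero_iff.2 hx0
    have h1 := hN ((‖x‖ : 𝕜)⁻¹ • x) ⟨(‖x‖ : 𝕜)⁻¹ • ⟨x, hx⟩, by
      rw [mem_sphere_zero_iff_norm, norm_smul, norm_inv, RCLike.norm_ofReal, abs_norm]
      exact inv_mul_cancel₀ hn, rfl⟩ ((‖x‖ : 𝕜)⁻¹ • z) (Submodule.smul_mem _ _ hz)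
    rw [← smul_add, norm_smul, norm_inv, RCLike.norm_ofReal, abs_norm,
      inv_le_iff_one_le_mul₀' hK0, ← mul_assoc, mul_comm K, mul_assoc,
      le_inv_mul_iff₀ (by positivity), mul_one] at h1
    exact h1

theorem IsNorming.boundedWeightBlocksSeparate {r : ℝ} (hf : IsNorming r f) (hr : 0 < r)
    (hB : IsMarkushevichBasis e f) : BoundedWeightBlocksSeparate e f w r⁻¹ := by
  rintro v ⟨b, n, m, hnm, hne, hv⟩ -
  refine sInf_le ⟨r⁻¹, inv_pos.2 hr, fun Z _ δ hδ => ?_, rfl⟩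
  set K := r⁻¹ + δ with hKdef
  have hK : r⁻¹ < K := by rw [hKdef]; linarith
  have hK0 : 0 < K := (inv_pos.2 hr).trans hK
  have hnlt : ∀ i, n i < n (i + 1) := fun i => (hnm i).1.trans_lt (hnm i).2
  have hnmono : StrictMono n := strictMono_nat_of_lt_succ hnlt
  have hid : ∀ i, i ≤ n i := hnmono.id_le
  -- the blocks lie in the tails of the basis
  have hvtail : ∀ N k, N ≤ n k → v k ∈ Submodule.span 𝕜 (e '' Set.Ici N) := by
    intro N k hNk
    rw [hv]
    exact signedSum_mem_span b fun i hi => hNk.trans (Finset.mem_Icc.1 hi).1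
  have hsep : ∀ p : ℕ, ∃ N, ∀ x ∈ Submodule.span 𝕜 (v '' Set.Iic p),
      ∀ z ∈ (Submodule.span 𝕜 (e '' Set.Ici N)).topologicalClosure, ‖x‖ ≤ K * ‖x + z‖ := by
    intro p
    have : FiniteDimensional 𝕜 (Submodule.span 𝕜 (v '' Set.Iic p)) :=
      FiniteDimensional.span_of_finite 𝕜 ((Set.finite_Iic p).image v)
    exact hf.exists_forall_le hr hB _ hK
  choose J hJ using hsep
  -- Each new block starts past the tail index that separates the span of all blocks up to the
  -- previous chosen one; this yields Grunblum's inequality.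
  let φ : ℕ → ℕ := fun k => Nat.rec 0 (fun _ p => max (p + 1) (J p)) k
  have hφ : ∀ k, φ (k + 1) = max (φ k + 1) (J (φ k)) := fun k => rfl
  have hφmono : StrictMono φ := strictMono_nat_of_lt_succ fun k => by rw [hφ]; omega
  -- functionals biorthogonal to the blocks
  choose κ hκ hbκ using hne
  have hcoord : ∀ i j, f (κ i) (v j) = if i = j then b (κ i) else 0 := by
    intro i j
    have h1 : f (κ i) (v j) = if κ i ∈ Finset.Icc (n j) (m j) then b (κ i) else 0 := by
      rw [hv]
      exact hB.coord_signedSum b _ _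
    rw [h1]
    have h2 := Finset.mem_Icc.1 (hκ i)
    rcases Nat.lt_trichotomy i j with h | rfl | h
    · have h3 := hnmono.monotone (show i + 1 ≤ j from h)
      have h4 := hnm i
      rw [if_neg h.ne, if_neg]
      rw [Finset.mem_Icc]
      omega
    · rw [if_pos (hκ i), if_pos rfl]
    · have h3 := hnmono.monotone (show j + 1 ≤ i from h)
      have h4 := hnm j
      rw [if_neg h.ne', if_neg]
      rw [Finset.mem_Icc]
      omega
  refine ⟨φ, hφmono, ?_, ?_⟩
  · refine isBasicSequenceWith_of_le (g := fun i => (b (κ (φ i)))⁻¹ • f (κ (φ i))) ?_ hK0.le ?_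
    · intro i j
      rw [smul_apply, Function.comp, hcoord, smul_eq_mul]
      simp only [hφmono.injective.eq_iff]
      split_ifs
      · exact inv_mul_cancel₀ (hbκ _)
      · exact mul_zero _
    · intro k p hp z hz
      cases k with
      | zero =>
        have hp0 : p = 0 := by simpa using hp
        rw [hp0, norm_zero]
        positivity
      | succ k =>
        have hle : Submodule.span 𝕜 (v ∘ φ '' Set.Ici (k + 1))
            ≤ Submodule.span 𝕜 (e '' Set.Ici (J (φ k))) := by
          rw [Submodule.span_le]
          rintro _ ⟨i, hi, rfl⟩
          refine hvtail _ _ (le_trans ?_ (hid _))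
          refine le_trans ?_ (hφmono.monotone (show k + 1 ≤ i from hi))
          rw [hφ]
          exact le_max_right _ _
        refine hJ (φ k) p (Submodule.span_mono ?_ hp) z (Submodule.le_topologicalClosure _ (hle hz))
        rintro _ ⟨i, hi, rfl⟩
        exact ⟨φ i, hφmono.monotone (Nat.lt_succ_iff.1 hi), rfl⟩
  · intro F hF _
    obtain ⟨N, hN⟩ := hf.exists_forall_le hr hB F hK
    refine ⟨N, fun x hx z hz => hN x hx z (Submodule.topologicalClosure_mono ?_ hz)⟩
    rw [Submodule.span_le]
    rintro _ ⟨k, hk, rfl⟩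
    exact hvtail _ _ (hk.le.trans ((hφmono.id_le k).trans (hid _)))

end WeightGreedy

theorem mainTheorem2 {𝕜 : Type*} [RCLike 𝕜] {X : Type*} [NormedAddCommGroup X]
    [NormedSpace 𝕜 X] [CompleteSpace X]
    (e : ℕ → X) (f : ℕ → StrongDual 𝕜 X) (hB : WeightGreedy.IsMarkushevichBasis e f)
    (w : ℕ → ℝ) (hw : ∀ i, 0 < w i)
    (C s : ℝ) (hC : 0 < C) (hs : 0 < s) (hs1 : s ≤ 1)
    (hSG : WeightGreedy.IsWeakSemiGreedy f w C s)
    (hsub : ∃ φ : ℕ → ℕ, StrictMono φ ∧ Tendsto (w ∘ φ) atTop (𝓝 0) ∧ ¬ Summable (w ∘ φ)) :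
    (∀ M : ℝ, 0 < M → WeightGreedy.BoundedWeightBlocksSeparate e f w M →
      WeightGreedy.ThresholdingEstimates e f w C s M) ∧
    (∀ r : ℝ, 0 < r → r ≤ 1 → WeightGreedy.IsNorming r f →
      WeightGreedy.BoundedWeightBlocksSeparate e f w r⁻¹ ∧
      WeightGreedy.ThresholdingEstimates e f w C s r⁻¹) :=
  ⟨fun _ hM0 hM => WeightGreedy.thresholdingEstimates hB hw hC hs hs1 hSG hsub hM0 hM,
    fun _ hr _ hf =>
      have hM := hf.boundedWeightBlocksSeparate hr hB
      ⟨hM, WeightGreedy.thresholdingEstimates hB hw hC hs hs1 hSG hsub (inv_pos.2 hr) hM⟩⟩
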